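/- Let $n$ be a positive integer and let $E\subseteq\mathbb{R}^n$ be a Kakeya set, i.e. a compact set containing a unit line segment in every direction $e\in\mathbb{S}^{n-1}$. Suppose that there is a map $a\colon\mathbb{S}^{n-1}\to\mathbb{R}^n$ such that $\psi(e,t)=a(e)+te$ maps $\mathbb{S}^{n-1}\times[0,1]$ into $E$ and (i) (effectively bi-Lipschitz) there are computable real constants $L_1,L_2>0$ with $$L_1\|(e_1,t_1)-(e_2,t_2)\|\le\|\psi(e_1,t_1)-\psi(e_2,t_2)\|\le L_2\|(e_1,t_1)-(e_2,t_2)\|$$ for all $(e_1,t_1),(e_2,t_2)\in\mathbb{S}^{n-1}\times[0,1]$; (ii) (identifiable) $\psi$ is injective on $\mathbb{S}^{n-1}\times[0,1]$; (iii) (computable with effective modulus) there are a computable function $m\colon\mathbb{N}\to\mathbb{N}$ and an algorithm which, given $r$ and any dyadic approximation of a point $(e,t)\in\mathbb{S}^{n-1}\times[0,1]$ with coordinatewise error at most $2^{-m(r)}$, outputs a dyadic approximation of $\psi(e,t)$ with coordinatewise error at most $2^{-r}$. For an oracle $A\subseteq\mathbb{N}$ let $K^A(\sigma)$ and $K^A(\sigma\mid\tau)$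 denote prefix-free Kolmogorov complexity and conditional prefix-free Kolmogorov complexity relative to $A$, defined through any fixed universal prefix-free machine with oracle $A$. For a point $w$ of a Euclidean space let $w{\upharpoonright}r$ be its nearest point in the grid of points with coordinates in $2^{-r}\mathbb{Z}$, and put $$\dim^A(w)=\liminf_{r\to\infty}\frac{K^A(w{\upharpoonright}r)}{r},\qquad \dim^{A,e}(t)=\liminf_{r\to\infty}\frac{K^A(t{\upharpoonright}r\mid e{\upharpoonright}r)}{r}.$$ Then for every oracle $A$ and every point $x=a(e)+te\in E$ with $e\in\mathbb{S}^{n-1}$ and $t\in[0,1]$ such that $\dim^A(e)=n-1$ and $\dim^{A,e}(t)=1$, $$\dim^A(x)=n.$$ -/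

import Mathlib

open Set Filter

noncomputable section

namespace Kakeya

/-! ### Prefix-free Kolmogorov complexity relative to an oracle -/

/-- The oracle `A ⊆ ℕ`, as its characteristic function. -/
def oracle (A : Set ℕ) : ℕ →. ℕ := fun k =>
  open Classical in Part.some (if k ∈ A then 1 else 0)

/-- A machine takes a binary program and side information, and outputs a finite object if it
halts. Finite objects are represented by their code numbers. -/
abbrev Machine : Type := List Bool × ℕ →. ℕ

/-- `M` is a prefix-free machine with oracle `A`: it is partial recursive in `A`, and for every
side information `y` no halting program is a proper prefix of another halting program. -/
structure IsPrefixMachine (A : Set ℕ) (M : Machine) : Prop where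
  recursiveIn : RecursiveIn {oracle A} M
  prefixFree : ∀ (y : ℕ) (p q : List Bool),
    (M (p, y)).Dom → (M (q, y)).Dom → p <+: q → p = q

/-- `U` is a universal prefix-free machine with oracle `A`: it simulates every prefix-free machine
with oracle `A`, with programs longer by at most an additive constant. -/
structure IsUniversalMachine (A : Set ℕ) (U : Machine) : Prop where
  isPrefixMachine : IsPrefixMachine A U
  universal : ∀ M : Machine, IsPrefixMachine A M →
    ∃ c : ℕ, ∀ (p : List Bool) (y s : ℕ), s ∈ M (p, y) →
      ∃ q : List Bool, s ∈ U (q, y) ∧ q.length ≤ p.length + c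

/-- Conditional complexity `K(s ∣ y)`: the length of a shortest program from which `U` outputs `s`
when given `y`. (If `U` is universal there is always such a program.) -/
def condComplexity (U : Machine) (s y : ℕ) : ℕ :=
  sInf {k : ℕ | ∃ p : List Bool, p.length = k ∧ s ∈ U (p, y)}

/-- Complexity `K(s)`: complexity with empty side information, coded by `0`. -/
def complexity (U : Machine) (s : ℕ) : ℕ := condComplexity U s 0

/-! ### Points at finite precision, and algorithmic dimension -/

/-- `x ↾ r`: (the code of) the nearest point of the dyadic grid `(2⁻ʳ ℤ)ⁿ` to `x`, given by the
list of its numerators. -/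
def approx {n : ℕ} (x : EuclideanSpace ℝ (Fin n)) (r : ℕ) : ℕ :=
  Encodable.encode (List.ofFn fun i : Fin n => round ((2 : ℝ) ^ r * x i))

/-- `t ↾ r` for a real number `t`. -/
def approxReal (t : ℝ) (r : ℕ) : ℕ :=
  Encodable.encode [round ((2 : ℝ) ^ r * t)]

/-- The algorithmic dimension `liminf K(x ↾ r) / r` of a point. If `U` is a universal prefix-free
machine with oracle `A`, this is the dimension of `x` relative to `A`. -/
def algDim (U : Machine) {n : ℕ} (x : EuclideanSpace ℝ (Fin n)) : EReal :=
  liminf (fun r : ℕ => (((complexity U (approx x r) : ℝ) / (r : ℝ) : ℝ) : EReal)) atTop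

/-- The algorithmic dimension `liminf K(t ↾ r ∣ e ↾ r) / r` of a real number `t` given `e`. If `U`
is a universal prefix-free machine with oracle `A`, this is the dimension of `t` relative to `A`
and `e`. -/
def condAlgDim (U : Machine) {n : ℕ} (t : ℝ) (e : EuclideanSpace ℝ (Fin n)) : EReal :=
  liminf (fun r : ℕ =>
    (((condComplexity U (approxReal t r) (approx e r) : ℝ) / (r : ℝ) : ℝ) : EReal)) atTop

/-! ### Kakeya sets and their parametrizations -/

/-- A Kakeya set: a compact set which contains a unit segment in every direction. -/
def IsKakeyaSet {n : ℕ} (E : Set (EuclideanSpace ℝ (Fin n))) : Prop :=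
  IsCompact E ∧ ∀ e ∈ Metric.sphere (0 : EuclideanSpace ℝ (Fin n)) 1,
    ∃ a : EuclideanSpace ℝ (Fin n), ∀ t ∈ Icc (0 : ℝ) 1, a + t • e ∈ E

/-- The parameter domain `𝕊ⁿ⁻¹ × [0,1]`. -/
def paramDomain (n : ℕ) : Set (EuclideanSpace ℝ (Fin n) × ℝ) :=
  Metric.sphere 0 1 ×ˢ Icc 0 1

/-- The parametrization `(e, t) ↦ a(e) + t e`. Only its values on `paramDomain n` matter. -/
def segmentMap {n : ℕ} (a : EuclideanSpace ℝ (Fin n) → EuclideanSpace ℝ (Fin n)) :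
    EuclideanSpace ℝ (Fin n) × ℝ → EuclideanSpace ℝ (Fin n) :=
  fun z => a z.1 + z.2 • z.1

/-- A computable real number: its dyadic approximations are given by a computable function. -/
def IsComputableReal (L : ℝ) : Prop :=
  ∃ f : ℕ → ℤ, Computable f ∧ ∀ r : ℕ, |(f r : ℝ) / 2 ^ r - L| ≤ 1 / 2 ^ r

/-- Bi-Lipschitz on `S` with computable constants, for the Euclidean norm
`‖(z, u)‖ = √(‖z‖² + u²)` on the product. -/
def EffectivelyBiLipschitzOn {n : ℕ}
    (ψ : EuclideanSpace ℝ (Fin n) × ℝ → EuclideanSpace ℝ (Fin n))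
    (S : Set (EuclideanSpace ℝ (Fin n) × ℝ)) : Prop :=
  ∃ L₁ L₂ : ℝ, 0 < L₁ ∧ 0 < L₂ ∧ IsComputableReal L₁ ∧ IsComputableReal L₂ ∧
    ∀ z₁ ∈ S, ∀ z₂ ∈ S,
      L₁ * √(‖z₁.1 - z₂.1‖ ^ 2 + (z₁.2 - z₂.2) ^ 2) ≤ ‖ψ z₁ - ψ z₂‖ ∧
      ‖ψ z₁ - ψ z₂‖ ≤ L₂ * √(‖z₁.1 - z₂.1‖ ^ 2 + (z₁.2 - z₂.2) ^ 2)

/-- `ψ` is computable on `S` with an effective modulus `m`: an algorithm computes the value of `ψ`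
at any point of `S` to within `2⁻ʳ` from `r` and any dyadic approximation of the point to within
`2⁻ᵐ⁽ʳ⁾`. Dyadic vectors are given by their numerators, errors are measured coordinatewise. -/
def EffectivelyComputableOn {n : ℕ}
    (ψ : EuclideanSpace ℝ (Fin n) × ℝ → EuclideanSpace ℝ (Fin n))
    (S : Set (EuclideanSpace ℝ (Fin n) × ℝ)) : Prop :=
  ∃ (m : ℕ → ℕ) (F : ((Fin n → ℤ) × ℤ) × ℕ → (Fin n → ℤ)), Computable m ∧ Computable F ∧
    ∀ z ∈ S, ∀ (r : ℕ) (p : Fin n → ℤ) (q : ℤ),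
      (∀ i, |(p i : ℝ) / 2 ^ m r - z.1 i| ≤ 1 / 2 ^ m r) →
      |(q : ℝ) / 2 ^ m r - z.2| ≤ 1 / 2 ^ m r →
      ∀ i, |(F ((p, q), r) i : ℝ) / 2 ^ r - ψ z i| ≤ 1 / 2 ^ r

end Kakeya

end

/-! Upper bound: the grid approximation of `x` at precision `r` is an integer vector in a box with
`2 ^ (r * n + O(1))` points, so its complexity is at most `r * n + O(log r)`.

Lower bound: up to `O(log r)`, `K(e ↾ r) + K(t ↾ r ∣ e ↾ r) ≤ K(x ↾ r)`. Dividing by `r` and using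
superadditivity of `liminf` gives `(n - 1) + 1 ≤ dim x`. The inequality has two ingredients.

Geometry: a computable relation, `parameterTest`, links a grid point `X` near `ψ z` to grid pairs
`(P, Q)` near `z`. The lower Lipschitz bound confines the pairs linked to one `X` to a box of
bounded size (`exists_abs_sub_le_of_parameterTest`, `exists_card_parameterTest_le`). Running all
programs of length `k = K(x ↾ r)` and listing the pairs linked to their outputs thus enumerates,
from `r` and `k`, at most `2 ^ (k + O(1))` pairs, among them `(e ↾ r, t ↾ r)`
(`exists_complexity_add_le_of_relation`).

Counting: let about `2 ^ j` of the enumerated pairs have first entry `P`. Given `P`, the entry `Q`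
is found from its position among them, with `j + 1` bits. At most `2 ^ (k - j)` first entries have
so many pairs, so `P` is found with `k - j` bits (`exists_complexity_add_condComplexity_le`).

Descriptions by position become programs through a self-delimiting code with logarithmic header.
Oracle computations are handled as computable functions of finite prefixes of the oracle. -/

namespace Kakeya

/-! ### Oracle computations from finite prefixes of the oracle -/

/-- The first `k` answers of the oracle `A`. -/
noncomputable def oraclePrefix (A : Set ℕ) (k : ℕ) : List ℕ :=
  open Classical in (List.range k).map fun i => if i ∈ A then 1 else 0

theorem oraclePrefix_length (A : Set ℕ) (k : ℕ) : (oraclePrefix A k).length = k := by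
  simp [oraclePrefix]

theorem take_oraclePrefix (A : Set ℕ) {i k : ℕ} (h : i ≤ k) :
    (oraclePrefix A k).take i = oraclePrefix A i := by
  simp [oraclePrefix, ← List.map_take, List.take_range, h]

/-- `g` computes `f` in the limit from finite prefixes of the oracle. -/
structure ApproximatesFrom (A : Set ℕ) (f : ℕ →. ℕ) (g : List ℕ → ℕ →. ℕ) : Prop where
  partrec : Partrec₂ g
  sound : ∀ k n a, a ∈ g (oraclePrefix A k) n → a ∈ f n
  complete : ∀ n a, a ∈ f n → ∀ᶠ k in atTop, a ∈ g (oraclePrefix A k) n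

theorem exists_approximatesFrom_of_partrec (A : Set ℕ) {f : ℕ →. ℕ} (hf : Nat.Partrec f) :
    ∃ g, ApproximatesFrom A f g :=
  ⟨fun _ n => f n, (Partrec.nat_iff.2 hf).comp Computable.snd, fun _ _ _ h => h,
    fun _ _ h => Eventually.of_forall fun _ => h⟩

/-- A halting computation makes finitely many queries. The proof is an induction on the derivation
of `f`; `complete` asks for all large `k`, not just one, so that the finitely many subcomputations
can share a prefix. -/
theorem exists_approximatesFrom (A : Set ℕ) {f : ℕ →. ℕ}
    (hf : Nat.RecursiveIn {oracle A} f) : ∃ g, ApproximatesFrom A f g := by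
  induction hf with
  | zero => exact exists_approximatesFrom_of_partrec A .zero
  | succ => exact exists_approximatesFrom_of_partrec A .succ
  | left => exact exists_approximatesFrom_of_partrec A .left
  | right => exact exists_approximatesFrom_of_partrec A .right
  | oracle g hg =>
    obtain rfl : g = oracle A := hg
    -- A query beyond the prefix diverges instead of receiving a default answer; this keeps the
    -- approximation sound.
    refine ⟨fun σ n => (σ[n]? : Option ℕ), ?_, ?_, ?_⟩
    · exact (Computable.ofOption (Computable.list_getElem?.comp Computable.fst Computable.snd))
    · intro k n a h
      simp only [oraclePrefix, Part.mem_coe, List.getElem?_map, Option.map_eq_some_iff,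
        Option.mem_def] at h
      obtain ⟨i, hi, rfl⟩ := h
      have := List.getElem?_eq_some_iff.1 hi
      simp only [List.length_range, List.getElem_range, exists_prop] at this
      rw [← this.2]
      exact Part.mem_some _
    · intro n a h
      filter_upwards [eventually_gt_atTop n] with k hk
      simp only [oracle, Part.mem_some_iff] at h
      rw [h]
      simp only [oraclePrefix, List.getElem?_map, List.getElem?_range hk]
      exact Part.mem_some _
  | @pair f h _ _ ihf ihh =>
    obtain ⟨f', hf1, hf2, hf3⟩ := ihf
    obtain ⟨h', hh1, hh2, hh3⟩ := ihh
    refine ⟨fun σ n => Nat.pair <$> f' σ n <*> h' σ n, ?_, ?_, ?_⟩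
    · have : Partrec fun p : List ℕ × ℕ => (f' p.1 p.2).bind fun u =>
          (h' p.1 p.2).map fun v => Nat.pair u v := by
        refine Partrec.bind hf1 (Partrec.map (hh1.comp (Computable.fst.comp Computable.fst)
          (Computable.snd.comp Computable.fst)) ?_)
        exact (Primrec₂.natPair.comp (Primrec.snd.comp Primrec.fst) Primrec.snd).to_comp
      refine this.of_eq fun p => ?_
      simp [Seq.seq]
    · intro k n a
      simp only [Seq.seq, Part.map_eq_map, Part.bind_map, Part.mem_bind_iff, Part.mem_map_iff]
      rintro ⟨u, hu, v, hv, rfl⟩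
      exact ⟨u, hf2 _ _ _ hu, v, hh2 _ _ _ hv, rfl⟩
    · intro n a
      simp only [Seq.seq, Part.map_eq_map, Part.bind_map, Part.mem_bind_iff, Part.mem_map_iff]
      rintro ⟨u, hu, v, hv, rfl⟩
      filter_upwards [hf3 _ _ hu, hh3 _ _ hv] with k h1 h2
      exact ⟨u, h1, v, h2, rfl⟩
  | @comp f h _ _ ihf ihh =>
    obtain ⟨f', hf1, hf2, hf3⟩ := ihf
    obtain ⟨h', hh1, hh2, hh3⟩ := ihh
    refine ⟨fun σ n => (h' σ n).bind (f' σ), ?_, ?_, ?_⟩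
    · exact Partrec.bind hh1 (hf1.comp (Computable.fst.comp Computable.fst) Computable.snd)
    · intro k n a h
      obtain ⟨u, hu, hv⟩ := Part.mem_bind_iff.1 h
      exact Part.mem_bind_iff.2 ⟨u, hh2 _ _ _ hu, hf2 _ _ _ hv⟩
    · intro n a h
      obtain ⟨u, hu, hv⟩ := Part.mem_bind_iff.1 h
      filter_upwards [hh3 _ _ hu, hf3 _ _ hv] with k h1 h2
      exact Part.mem_bind_iff.2 ⟨u, h1, h2⟩
  | @prec f h _ _ ihf ihh =>
    obtain ⟨f', hf1, hf2, hf3⟩ := ihf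
    obtain ⟨h', hh1, hh2, hh3⟩ := ihh
    refine ⟨fun σ p => Nat.rec (f' σ p.unpair.1)
      (fun y IH => IH.bind fun i => h' σ (Nat.pair p.unpair.1 (Nat.pair y i))) p.unpair.2,
      ?_, ?_, ?_⟩
    · have h1 : Computable fun p : List ℕ × ℕ => p.2.unpair.2 :=
        Computable.snd.comp (Computable.unpair.comp Computable.snd)
      have h2 : Computable fun p : List ℕ × ℕ => p.2.unpair.1 :=
        Computable.fst.comp (Computable.unpair.comp Computable.snd)
      refine Partrec.nat_rec (f := fun p : List ℕ × ℕ => p.2.unpair.2)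
        (g := fun p : List ℕ × ℕ => f' p.1 p.2.unpair.1)
        (h := fun p q => h' p.1 (Nat.pair p.2.unpair.1 (Nat.pair q.1 q.2))) h1
        (hf1.comp Computable.fst h2) ?_
      refine hh1.comp (Computable.fst.comp Computable.fst) ?_
      refine (Primrec₂.natPair.to_comp.comp (h2.comp Computable.fst) ?_)
      exact Primrec₂.natPair.to_comp.comp (Computable.fst.comp Computable.snd)
        (Computable.snd.comp Computable.snd)
    · intro k p a
      simp only
      generalize p.unpair.1 = u
      generalize p.unpair.2 = n
      induction n generalizing a with
      | zero => exact hf2 _ _ _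
      | succ n ih =>
        intro h
        obtain ⟨i, hi, hv⟩ := Part.mem_bind_iff.1 h
        exact Part.mem_bind_iff.2 ⟨i, ih _ hi, hh2 _ _ _ hv⟩
    · intro p a
      simp only
      generalize p.unpair.1 = u
      generalize p.unpair.2 = n
      induction n generalizing a with
      | zero => exact hf3 _ _
      | succ n ih =>
        intro h
        obtain ⟨i, hi, hv⟩ := Part.mem_bind_iff.1 h
        filter_upwards [ih _ hi, hh3 _ _ hv] with k h1 h2
        exact Part.mem_bind_iff.2 ⟨i, h1, h2⟩
  | @rfind f _ ihf =>
    obtain ⟨f', hf1, hf2, hf3⟩ := ihf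
    refine ⟨fun σ a => Nat.rfind fun n => (f' σ (Nat.pair a n)).map (fun m => decide (m = 0)),
      ?_, ?_, ?_⟩
    · refine Partrec.rfind (p := fun (p : List ℕ × ℕ) n =>
        (f' p.1 (Nat.pair p.2 n)).map (fun m => decide (m = 0))) ?_
      refine Partrec.map (f := fun q : (List ℕ × ℕ) × ℕ => f' q.1.1 (Nat.pair q.1.2 q.2))
        (g := fun _ m => decide (m = 0)) ?_ ?_
      · exact hf1.comp (Computable.fst.comp Computable.fst) (Primrec₂.natPair.to_comp.comp
          (Computable.snd.comp Computable.fst) Computable.snd)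
      · exact ((Primrec.eq.decide.comp Primrec.snd (Primrec.const 0))).to_comp
    · intro k n a h
      obtain ⟨h1, h2⟩ := Nat.mem_rfind.1 h
      refine Nat.mem_rfind.2 ⟨?_, fun {m} hm => ?_⟩
      · obtain ⟨u, hu, hu'⟩ := (Part.mem_map_iff _).1 h1
        exact (Part.mem_map_iff _).2 ⟨u, hf2 _ _ _ hu, by simpa using hu'⟩
      · obtain ⟨u, hu, hu'⟩ := (Part.mem_map_iff _).1 (h2 hm)
        exact (Part.mem_map_iff _).2 ⟨u, hf2 _ _ _ hu, by simpa using hu'⟩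
    · intro n a h
      obtain ⟨h1, h2⟩ := Nat.mem_rfind.1 h
      have e1 : ∀ᶠ k in atTop, true ∈ (f' (oraclePrefix A k) (Nat.pair n a)).map
          (fun m => decide (m = 0)) := by
        obtain ⟨u, hu, hu'⟩ := (Part.mem_map_iff _).1 h1
        filter_upwards [hf3 _ _ hu] with k hk
        exact (Part.mem_map_iff _).2 ⟨u, hk, by simpa using hu'⟩
      have e2 : ∀ᶠ k in atTop, ∀ m ∈ Finset.range a,
          false ∈ (f' (oraclePrefix A k) (Nat.pair n m)).map (fun m => decide (m = 0)) := by
        rw [Filter.eventually_all_finset]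
        intro m hm
        obtain ⟨u, hu, hu'⟩ := (Part.mem_map_iff _).1 (h2 (Finset.mem_range.1 hm))
        filter_upwards [hf3 _ _ hu] with k hk
        exact (Part.mem_map_iff _).2 ⟨u, hk, by simpa using hu'⟩
      filter_upwards [e1, e2] with k h1 h2
      exact Nat.mem_rfind.2 ⟨h1, fun {m} hm => h2 m (Finset.mem_range.2 hm)⟩

/-! ### Stagewise enumeration and its equivalence with recursiveness in the oracle -/

section Stages

variable {α σ : Type*} [Primcodable α] [Primcodable σ]

/-- `H` enumerates the graph of `f`: a computable function of the argument and of the answers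
of the oracle so far which outputs the value of `f` at some stage. -/
structure IsStaging (A : Set ℕ) (f : α →. σ) (H : α → List ℕ → Option σ) : Prop where
  computable : Computable₂ H
  mem_iff : ∀ a s, s ∈ f a ↔ ∃ k, H a (oraclePrefix A k) = some s

theorem exists_isStaging_nat (A : Set ℕ) {f : ℕ →. ℕ} (hf : Nat.RecursiveIn {oracle A} f) :
    ∃ H, IsStaging A f H := by
  obtain ⟨g, hg⟩ := exists_approximatesFrom A hf
  obtain ⟨c, hc⟩ := Nat.Partrec.Code.exists_code.1 (Partrec.nat_iff.1
    (hg.partrec.comp ((Computable.ofNat (List ℕ)).comp (Computable.fst.comp Computable.unpair))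
      (Computable.snd.comp Computable.unpair)))
  have hc' : ∀ τ n, c.eval (Nat.pair (Encodable.encode (τ : List ℕ)) n) = g τ n := by
    intro τ n
    rw [hc]; simp
  -- The length of `τ` codes a pair: how much of the oracle to use, and a bound for the evaluation.
  -- A component never exceeds the code of its pair, so `τ` is long enough.
  refine ⟨fun n τ => Nat.Partrec.Code.evaln τ.length.unpair.2 c
    (Nat.pair (Encodable.encode (τ.take τ.length.unpair.1)) n), ?_, ?_⟩
  · refine (Nat.Partrec.Code.primrec_evaln.comp (Primrec.pair (Primrec.pair ?_ (Primrec.const c))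
      ?_)).to_comp
    · exact Primrec.snd.comp (Primrec.unpair.comp (Primrec.list_length.comp Primrec.snd))
    · refine Primrec₂.natPair.comp (Primrec.encode.comp (Primrec.list_take.comp ?_ Primrec.snd))
        Primrec.fst
      exact Primrec.fst.comp (Primrec.unpair.comp (Primrec.list_length.comp Primrec.snd))
  · intro n a
    constructor
    · intro h
      obtain ⟨k, hk⟩ := (hg.complete n a h).exists
      rw [← hc', Nat.Partrec.Code.evaln_complete] at hk
      obtain ⟨s, hs⟩ := hk
      refine ⟨Nat.pair k s, ?_⟩
      simp only [oraclePrefix_length, Nat.unpair_pair]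
      rw [take_oraclePrefix A (Nat.left_le_pair k s)]
      exact hs
    · rintro ⟨k, hk⟩
      simp only [oraclePrefix_length] at hk
      rw [take_oraclePrefix A (Nat.unpair_left_le k)] at hk
      have := Nat.Partrec.Code.evaln_sound (Option.mem_def.2 hk)
      rw [hc'] at this
      exact hg.sound _ _ _ this

theorem exists_isStaging (A : Set ℕ) {f : α →. ℕ} (hf : RecursiveIn {oracle A} f) :
    ∃ H, IsStaging A f H := by
  obtain ⟨H, hH1, hH2⟩ := exists_isStaging_nat A hf
  refine ⟨fun a τ => H (Encodable.encode a) τ, hH1.comp (Computable.encode.comp Computable.fst)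
    Computable.snd, fun a s => ?_⟩
  rw [← hH2]
  simp

theorem recursiveIn_oraclePrefix (A : Set ℕ) :
    Nat.RecursiveIn {oracle A} fun k => Part.some (Encodable.encode (oraclePrefix A k)) := by
  have hstep : Nat.RecursiveIn {oracle A} fun p => Part.some
      (Encodable.encode (Denumerable.ofNat (List ℕ) p.unpair.2 ++ [p.unpair.1])) := by
    apply Nat.Partrec.recursiveIn
    refine Partrec.nat_iff.1 (Computable.partrec (f := fun p : ℕ =>
      Encodable.encode (Denumerable.ofNat (List ℕ) p.unpair.2 ++ [p.unpair.1])) ?_)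
    refine (Primrec.encode.comp (Primrec.list_concat.comp ((Primrec.ofNat (List ℕ)).comp
      (Primrec.snd.comp Primrec.unpair)) (Primrec.fst.comp Primrec.unpair))).to_comp
  have hy : Nat.RecursiveIn {oracle A} fun p => Part.some p.unpair.2.unpair.1 :=
    Nat.Primrec.recursiveIn (Nat.Primrec.left.comp Nat.Primrec.right)
  have hi : Nat.RecursiveIn {oracle A} fun p => Part.some p.unpair.2.unpair.2 :=
    Nat.Primrec.recursiveIn (Nat.Primrec.right.comp Nat.Primrec.right)
  have hO : Nat.RecursiveIn {oracle A} (oracle A) := .oracle _ rfl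
  have hnil : Nat.RecursiveIn {oracle A} fun _ => Part.some (Encodable.encode ([] : List ℕ)) :=
    Nat.Primrec.recursiveIn (Nat.Primrec.const _)
  have hprec := Nat.RecursiveIn.prec hnil (.comp hstep (.pair (.comp hO hy) hi))
  have hin : Nat.RecursiveIn {oracle A} fun k => Part.some (Nat.pair 0 k) :=
    Nat.Primrec.recursiveIn (Nat.Primrec.pair (Nat.Primrec.const 0) Nat.Primrec.id)
  refine (Nat.RecursiveIn.comp hprec hin).of_eq fun k => ?_
  simp only [Part.bind_eq_bind, Part.bind_some, Nat.unpair_pair]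
  induction k with
  | zero => simp [oraclePrefix]
  | succ k ih =>
    simp only [ih]
    have hk : (Part.some k >>= oracle A) = oracle A k := Part.bind_some _ _
    rw [hk]
    simp [oracle, oraclePrefix, List.range_succ, Seq.seq]

/-- A partial function whose graph is enumerated by stages is recursive in the oracle. -/
theorem IsStaging.recursiveIn {A : Set ℕ} {f : α →. σ} {H : α → List ℕ → Option σ}
    (hH : IsStaging A f H) : RecursiveIn {oracle A} f := by
  let T : ℕ → ℕ := fun p => Encodable.encode
    ((Encodable.decode (α := α) p.unpair.1).bind fun a =>
      H a (Denumerable.ofNat (List ℕ) p.unpair.2))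
  have hT : Computable T := by
    refine Computable.encode.comp (Computable.option_bind (Computable.decode.comp
      (Computable.fst.comp Computable.unpair)) (hH.computable.comp Computable.snd ?_))
    exact (Computable.ofNat (List ℕ)).comp (Computable.snd.comp
      (Computable.unpair.comp Computable.fst))
  have hTR : Nat.RecursiveIn {oracle A} fun p => Part.some (T p) :=
    Nat.Partrec.recursiveIn (Partrec.nat_iff.1 hT.partrec)
  have hleft : Nat.RecursiveIn {oracle A} fun p => Part.some p.unpair.1 :=
    Nat.Primrec.recursiveIn Nat.Primrec.left
  have hright : Nat.RecursiveIn {oracle A} fun p => Part.some p.unpair.2 :=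
    Nat.Primrec.recursiveIn Nat.Primrec.right
  have hstage := Nat.RecursiveIn.comp hTR
    (.pair hleft (.comp (recursiveIn_oraclePrefix A) hright))
  -- An `Option` is coded by `0` for `none` and by a successor for `some`. So `1 - p` vanishes
  -- exactly at a successful stage, which stops the unbounded search, and `p - 1` then recovers the
  -- value.
  have hcheck : Nat.RecursiveIn {oracle A} fun p => Part.some (1 - p) :=
    Nat.Primrec.recursiveIn (Primrec.nat_iff.1 (Primrec.nat_sub.comp (Primrec.const 1) Primrec.id))
  have hpred : Nat.RecursiveIn {oracle A} fun p => Part.some (p - 1) :=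
    Nat.Primrec.recursiveIn (Primrec.nat_iff.1 (Primrec.nat_sub.comp Primrec.id (Primrec.const 1)))
  have hid : Nat.RecursiveIn {oracle A} fun p => Part.some p :=
    Nat.Primrec.recursiveIn Nat.Primrec.id
  have hfind := Nat.RecursiveIn.comp hpred (.comp hstage (.pair hid (.rfind (.comp hcheck hstage))))
  refine hfind.of_eq fun n => ?_
  have hS : ∀ a k, T (Nat.pair a (Encodable.encode (oraclePrefix A k))) =
      Encodable.encode ((Encodable.decode (α := α) a).bind fun a => H a (oraclePrefix A k)) := by
    intro a k; simp [T]
  have hfn : ∀ k, k ∈ (Nat.rfind fun k => Part.some (decide (1 - T (Nat.pair n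
      (Encodable.encode (oraclePrefix A k))) = 0))) ↔ T (Nat.pair n
      (Encodable.encode (oraclePrefix A k))) ≠ 0 ∧ ∀ m < k, T (Nat.pair n
      (Encodable.encode (oraclePrefix A m))) = 0 := by
    intro k
    refine Nat.mem_rfind.trans ?_
    simp only [Part.mem_some_iff, eq_comm (a := true), eq_comm (a := false), decide_eq_true_eq,
      decide_eq_false_iff_not]
    refine and_congr (by omega) (forall_congr' fun m => forall_congr' fun _ => by omega)
  ext b
  simp only [Part.bind_eq_bind, Part.mem_bind_iff, Seq.seq, Part.map_eq_map, Part.mem_map_iff,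
    Part.mem_some_iff, Part.map_some, Part.bind_some, Nat.unpair_pair, hfn,
    Part.mem_coe, Option.mem_def]
  constructor
  · rintro ⟨c, ⟨d, ⟨k, ⟨h1, -⟩, rfl⟩, hc⟩, rfl⟩
    simp only [Nat.unpair_pair, hS] at h1 hc
    rcases hn : Encodable.decode (α := α) n with _ | x
    · simp [hn] at h1
    · rcases hk : H x (oraclePrefix A k) with _ | s
      · simp [hn, hk] at h1
      · exact ⟨x, rfl, s, (hH.mem_iff x s).2 ⟨k, hk⟩, by simp [hc, hn, hk]⟩
  · rintro ⟨x, hn, s, hs, rfl⟩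
    have hex := (hH.mem_iff x s).1 hs
    classical
    have hex' : ∃ k, (H x (oraclePrefix A k)).isSome := by
      obtain ⟨k, hk⟩ := hex; exact ⟨k, by simp [hk]⟩
    obtain ⟨s', hs'⟩ := Option.isSome_iff_exists.1 (Nat.find_spec hex')
    obtain rfl : s = s' := Part.mem_unique hs ((hH.mem_iff x s').2 ⟨_, hs'⟩)
    refine ⟨Encodable.encode s + 1, ⟨_, ⟨Nat.find hex', ⟨?_, ?_⟩, rfl⟩, ?_⟩, ?_⟩
    · simp [hS, hn, hs']
    · intro m hm
      have := Nat.find_min hex' hm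
      have : H x (oraclePrefix A m) = none := by simpa using this
      simp [hS, hn, this]
    · simp [hS, hn, hs']
    · simp

end Stages

end Kakeya

/-! ### Self-delimiting codes and the resulting complexity bounds -/

namespace Kakeya

theorem primrec₂_pow : Primrec₂ ((· ^ ·) : ℕ → ℕ → ℕ) :=
  Primrec₂.unpaired'.1 Nat.Primrec.pow

/-- The `k` lowest binary digits of `m`, lowest digit first. -/
def binaryDigits (k m : ℕ) : List Bool :=
  (List.range k).map fun i => decide (m / 2 ^ i % 2 = 1)

/-- The number with the given binary digits, lowest digit first. -/
def binaryValue (l : List Bool) : ℕ :=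
  l.foldr (fun b n => b.toNat + 2 * n) 0

theorem binaryDigits_length (k m : ℕ) : (binaryDigits k m).length = k := by
  simp [binaryDigits]

theorem binaryDigits_succ (k m : ℕ) :
    binaryDigits (k + 1) m = decide (m % 2 = 1) :: binaryDigits k (m / 2) := by
  simp [binaryDigits, List.range_succ_eq_map, Function.comp_def, Nat.div_div_eq_div_mul, pow_succ']

theorem binaryValue_binaryDigits {k m : ℕ} (h : m < 2 ^ k) :
    binaryValue (binaryDigits k m) = m := by
  induction k generalizing m with
  | zero => simp at h; simp [h, binaryDigits, binaryValue]
  | succ k ih =>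
    rw [binaryDigits_succ]
    have : binaryValue (decide (m % 2 = 1) :: binaryDigits k (m / 2)) =
        (decide (m % 2 = 1)).toNat + 2 * binaryValue (binaryDigits k (m / 2)) := rfl
    rw [this, ih (by rw [pow_succ] at h; omega)]
    rcases Nat.mod_two_eq_zero_or_one m with h0 | h1
    · simp [h0]; omega
    · simp [h1]; omega

theorem primrec₂_binaryDigits : Primrec₂ binaryDigits := by
  refine Primrec.list_map (Primrec.list_range.comp Primrec.fst) ?_
  refine Primrec.eq.decide.comp (Primrec.nat_mod.comp (Primrec.nat_div.comp
    (Primrec.snd.comp Primrec.fst) (primrec₂_pow.comp (Primrec.const 2) Primrec.snd))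
    (Primrec.const 2)) (Primrec.const 1)

theorem primrec_binaryValue : Primrec binaryValue := by
  refine Primrec.list_foldr (f := fun l : List Bool => l) (g := fun _ => 0)
    (h := fun _ p => p.1.toNat + 2 * p.2) Primrec.id (Primrec.const 0) ?_
  refine Primrec.nat_add.comp ((Primrec.dom_finite Bool.toNat).comp (Primrec.fst.comp Primrec.snd))
    (Primrec.nat_mul.comp (Primrec.const 2) (Primrec.snd.comp Primrec.snd))

/-- A self-delimiting code: the number `m` with `u.unpair.1` digits, preceded by a header which
contains `u` with `h` digits. -/
def blockCode (h u m : ℕ) : List Bool :=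
  (List.range h).map (fun _ => true) ++ (false :: (binaryDigits h u ++ binaryDigits u.unpair.1 m))

theorem blockCode_length (h u m : ℕ) : (blockCode h u m).length = u.unpair.1 + 2 * h + 1 := by
  simp [blockCode, binaryDigits_length]; omega

theorem primrec_blockCode : Primrec fun p : ℕ × ℕ × ℕ => blockCode p.1 p.2.1 p.2.2 := by
  have hu : Primrec fun p : ℕ × ℕ × ℕ => p.2.1 := Primrec.fst.comp Primrec.snd
  have hm : Primrec fun p : ℕ × ℕ × ℕ => p.2.2 := Primrec.snd.comp Primrec.snd
  refine Primrec.list_append.comp (Primrec.list_map (Primrec.list_range.comp Primrec.fst)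
    (Primrec₂.const true)) (Primrec.list_cons.comp (Primrec.const false) (Primrec.list_append.comp
    (primrec₂_binaryDigits.comp Primrec.fst hu) (primrec₂_binaryDigits.comp
    (Primrec.fst.comp (Primrec.unpair.comp hu)) hm)))

/-- The header length, header and content of a block code. -/
def blockParse (p : List Bool) : ℕ × ℕ × ℕ :=
  let h := (p.takeWhile id).length
  (h, binaryValue ((p.drop (h + 1)).take h), binaryValue ((p.drop (h + 1)).drop h))

theorem primrec_blockParse : Primrec blockParse := by
  have hh : Primrec fun p : List Bool => (p.takeWhile id).length :=
    Primrec.list_length.comp (Primrec.list_takeWhile Primrec.id)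
  have hd : Primrec fun p : List Bool => p.drop ((p.takeWhile id).length + 1) :=
    Primrec.list_drop.comp (Primrec.succ.comp hh) Primrec.id
  exact Primrec.pair hh (Primrec.pair (primrec_binaryValue.comp (Primrec.list_take.comp hh hd))
    (primrec_binaryValue.comp (Primrec.list_drop.comp hh hd)))

theorem takeWhile_blockCode (h : ℕ) (t : List Bool) :
    (((List.range h).map (fun _ => true) ++ (false :: t)).takeWhile id) =
      (List.range h).map (fun _ => true) := by
  rw [List.takeWhile_append_of_pos (by simp)]
  simp

theorem drop_blockCode (h : ℕ) (t : List Bool) :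
    (((List.range h).map (fun _ => true) ++ (false :: t)).drop (h + 1)) = t := by
  rw [List.drop_append]
  simp

theorem blockParse_blockCode {h u m : ℕ} (hu : u < 2 ^ h) (hm : m < 2 ^ u.unpair.1) :
    blockParse (blockCode h u m) = (h, u, m) := by
  have h1 : ((blockCode h u m).takeWhile id).length = h := by
    rw [blockCode, takeWhile_blockCode]; simp
  have h2 : (blockCode h u m).drop (h + 1) = binaryDigits h u ++ binaryDigits u.unpair.1 m := by
    rw [blockCode, drop_blockCode]
  simp only [blockParse, h1, h2]
  rw [List.take_left' (binaryDigits_length _ _), List.drop_left' (binaryDigits_length _ _),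
    binaryValue_binaryDigits hu, binaryValue_binaryDigits hm]

/-- The unary part fixes the length of the header, and the header fixes the length of the content. A
code and its prefix therefore agree in `h` and `u`, hence in length. -/
theorem blockCode_eq_of_prefix {h u m h' u' m' : ℕ} (hu : u < 2 ^ h) (hu' : u' < 2 ^ h')
    (hp : blockCode h u m <+: blockCode h' u' m') : blockCode h u m = blockCode h' u' m' := by
  obtain ⟨t, ht⟩ := hp
  have e1 : h = h' := by
    have := congrArg (fun l : List Bool => (l.takeWhile id).length) ht
    simp only [blockCode, List.append_assoc, List.cons_append] at this
    rw [takeWhile_blockCode, takeWhile_blockCode] at this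
    simpa using this
  subst e1
  have e2 : u = u' := by
    have := congrArg (fun l : List Bool => (l.drop (h + 1)).take h) ht
    simp only [blockCode, List.append_assoc, List.cons_append] at this
    rw [drop_blockCode, drop_blockCode, List.take_left' (binaryDigits_length _ _),
      List.take_left' (binaryDigits_length _ _)] at this
    rw [← binaryValue_binaryDigits hu, this, binaryValue_binaryDigits hu']
  subst e2
  have := congrArg List.length ht
  rw [List.length_append, blockCode_length, blockCode_length] at this
  have : t = [] := List.length_eq_zero_iff.1 (by omega)
  simpa [this] using ht

/-- The prefix-free machine which decodes a block code and then applies `f`. -/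
def blockMachine (f : (ℕ × ℕ) × ℕ →. ℕ) : Machine := fun x =>
  -- Re-encoding the parsed fields rejects every program that is not an exact block code.
  ⟨((blockParse x.1).2.1 < 2 ^ (blockParse x.1).1 ∧
      blockCode (blockParse x.1).1 (blockParse x.1).2.1 (blockParse x.1).2.2 = x.1) ∧
      (f ((blockParse x.1).2, x.2)).Dom, fun h => (f ((blockParse x.1).2, x.2)).get h.2⟩

theorem mem_blockMachine {f : (ℕ × ℕ) × ℕ →. ℕ} {x : List Bool × ℕ} {s : ℕ} :
    s ∈ blockMachine f x ↔ ((blockParse x.1).2.1 < 2 ^ (blockParse x.1).1 ∧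
      blockCode (blockParse x.1).1 (blockParse x.1).2.1 (blockParse x.1).2.2 = x.1) ∧
      s ∈ f ((blockParse x.1).2, x.2) := by
  constructor
  · rintro ⟨h, rfl⟩
    exact ⟨h.1, h.2, rfl⟩
  · rintro ⟨h, h2, rfl⟩
    exact ⟨⟨h, h2⟩, rfl⟩

variable {A : Set ℕ}

theorem isPrefixMachine_blockMachine {f : (ℕ × ℕ) × ℕ →. ℕ}
    {H : (ℕ × ℕ) × ℕ → List ℕ → Option ℕ} (hf : IsStaging A f H) :
    IsPrefixMachine A (blockMachine f) := by
  constructor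
  · refine IsStaging.recursiveIn (H := fun x τ => bif decide ((blockParse x.1).2.1 <
      2 ^ (blockParse x.1).1) && decide (blockCode (blockParse x.1).1 (blockParse x.1).2.1
      (blockParse x.1).2.2 = x.1) then H ((blockParse x.1).2, x.2) τ else none) ⟨?_, ?_⟩
    · have hp : Primrec fun q : (List Bool × ℕ) × List ℕ => blockParse q.1.1 :=
        primrec_blockParse.comp (Primrec.fst.comp Primrec.fst)
      refine Computable.cond (Primrec.to_comp ?_) (hf.computable.comp
        (Computable.pair (Primrec.snd.comp hp).to_comp
          (Computable.snd.comp Computable.fst)) Computable.snd) (Computable.const none)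
      refine Primrec.and.comp (Primrec.nat_lt.decide.comp (Primrec.fst.comp (Primrec.snd.comp hp))
        (primrec₂_pow.comp (Primrec.const 2) (Primrec.fst.comp hp)))
        (Primrec.eq.decide.comp (primrec_blockCode.comp hp) (Primrec.fst.comp Primrec.fst))
    · intro x s
      rw [mem_blockMachine, hf.mem_iff]
      by_cases hc : (blockParse x.1).2.1 < 2 ^ (blockParse x.1).1 ∧
        blockCode (blockParse x.1).1 (blockParse x.1).2.1 (blockParse x.1).2.2 = x.1
      · simp [hc]
      · have : (decide ((blockParse x.1).2.1 < 2 ^ (blockParse x.1).1) &&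
            decide (blockCode (blockParse x.1).1 (blockParse x.1).2.1 (blockParse x.1).2.2 = x.1))
            = false := by
          rw [← Bool.decide_and, decide_eq_false hc]
        simp [hc, this]
  · intro y p q hp hq hpq
    obtain ⟨s, hs⟩ := Part.dom_iff_mem.1 hp
    obtain ⟨s', hs'⟩ := Part.dom_iff_mem.1 hq
    obtain ⟨⟨h1, h2⟩, -⟩ := mem_blockMachine.1 hs
    obtain ⟨⟨h1', h2'⟩, -⟩ := mem_blockMachine.1 hs'
    simp only at h1 h2 h1' h2'
    rw [← h2, ← h2'] at hpq ⊢
    exact blockCode_eq_of_prefix h1 h1' hpq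

theorem condComplexity_le_length {U : Machine} {p : List Bool} {y s : ℕ} (h : s ∈ U (p, y)) :
    condComplexity U s y ≤ p.length :=
  Nat.sInf_le ⟨p, rfl, h⟩

/-- The source of all upper bounds on complexity: `l` bits of content cost `l`, while the content
length `l` and a parameter `v` travel in the header at cost `2 * h`. -/
theorem IsUniversalMachine.exists_condComplexity_le {U : Machine} (hU : IsUniversalMachine A U)
    {f : (ℕ × ℕ) × ℕ →. ℕ} {H : (ℕ × ℕ) × ℕ → List ℕ → Option ℕ} (hf : IsStaging A f H) :
    ∃ c, ∀ h l v m y s, Nat.pair l v < 2 ^ h → m < 2 ^ l → s ∈ f ((Nat.pair l v, m), y) →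
      condComplexity U s y ≤ l + 2 * h + c ∧ ∃ p, s ∈ U (p, y) := by
  obtain ⟨c, hc⟩ := hU.universal _ (isPrefixMachine_blockMachine hf)
  refine ⟨c + 1, fun h l v m y s hv hm hs => ?_⟩
  have hm' : m < 2 ^ (Nat.pair l v).unpair.1 := by simpa using hm
  obtain ⟨q, hq, hl⟩ := hc (blockCode h (Nat.pair l v) m) y s (mem_blockMachine.2 (by
    simp only [blockParse_blockCode hv hm']
    exact ⟨⟨hv, trivial⟩, hs⟩))
  refine ⟨(condComplexity_le_length hq).trans (hl.trans ?_), q, hq⟩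
  rw [blockCode_length, Nat.unpair_pair]
  simp only
  omega

/-- The infimum defining `condComplexity` is attained and is not the default value `0` of an empty
set: a machine with constant output `s` shows that some program exists. -/
theorem IsUniversalMachine.exists_program {U : Machine} (hU : IsUniversalMachine A U) (s y : ℕ) :
    ∃ p : List Bool, p.length = condComplexity U s y ∧ s ∈ U (p, y) := by
  have hf : IsStaging A (fun _ : (ℕ × ℕ) × ℕ => Part.some s) (fun _ _ => some s) :=
    ⟨Computable.const _, by simp [eq_comm]⟩
  obtain ⟨c, hc⟩ := hU.exists_condComplexity_le hf
  obtain ⟨-, p, hp⟩ := hc 1 0 0 0 y s (by simp [Nat.pair]) (by simp) (by simp)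
  exact Nat.sInf_mem (s := {k | ∃ p : List Bool, p.length = k ∧ s ∈ U (p, y)}) ⟨_, p, rfl, hp⟩

end Kakeya

/-! ### Descriptions by position in an enumeration, and the counting inequality -/

namespace Kakeya

/-- Append a value to a list unless it is there already. -/
def appendNew (l : List ℕ) (o : Option ℕ) : List ℕ :=
  o.elim l fun x => if x ∈ l then l else l ++ [x]

theorem mem_appendNew {l : List ℕ} {o : Option ℕ} {x : ℕ} :
    x ∈ appendNew l o ↔ x ∈ l ∨ o = some x := by
  rcases o with _ | y
  · simp [appendNew]
  · by_cases h : y ∈ l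
    · simp only [appendNew, Option.elim_some, h, if_true, Option.some.injEq]
      exact ⟨Or.inl, fun h' => h'.elim id fun e => e ▸ h⟩
    · simp [appendNew, h, eq_comm]

theorem nodup_appendNew {l : List ℕ} (hl : l.Nodup) (o : Option ℕ) : (appendNew l o).Nodup := by
  rcases o with _ | y
  · exact hl
  · by_cases h : y ∈ l
    · simpa [appendNew, h] using hl
    · simp only [appendNew, Option.elim_some, h, if_false]
      rw [List.nodup_append]
      exact ⟨hl, by simp, by rintro a ha b hb rfl; simp at hb; exact h (hb ▸ ha)⟩

theorem prefix_appendNew (l : List ℕ) (o : Option ℕ) : l <+: appendNew l o := by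
  rcases o with _ | y
  · exact List.prefix_rfl
  · by_cases h : y ∈ l <;> simp [appendNew, h]

theorem primrec₂_mem_list : Primrec₂ fun (x : ℕ) (l : List ℕ) => decide (x ∈ l) := by
  have : Primrec₂ fun (l : List ℕ) (x : ℕ) => decide (∃ a ∈ l, a = x) :=
    (PrimrecRel.exists_mem_list (R := fun a b : ℕ => a = b) Primrec.eq).decide
  refine this.swap.of_eq fun x l => ?_
  simp [Function.swap]

theorem primrec₂_appendNew : Primrec₂ appendNew := by
  refine (Primrec.option_casesOn (o := fun p : List ℕ × Option ℕ => p.2) (f := fun p => p.1)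
    (g := fun p x => bif decide (x ∈ p.1) then p.1 else p.1 ++ [x]) Primrec.snd Primrec.fst
    ?_).of_eq ?_
  · refine Primrec.cond (primrec₂_mem_list.comp Primrec.snd (Primrec.fst.comp Primrec.fst))
      (Primrec.fst.comp Primrec.fst)
      (Primrec.list_concat.comp (Primrec.fst.comp Primrec.fst) Primrec.snd)
  · rintro ⟨l, _ | x⟩ <;> simp [appendNew, Bool.cond_decide]

/-- The distinct values of a sequence of optional numbers before time `k`, in the order of their
first occurrence. -/
def distinctValues (w : ℕ → Option ℕ) : ℕ → List ℕ
  | 0 => []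
  | k + 1 => appendNew (distinctValues w k) (w k)

theorem mem_distinctValues {w : ℕ → Option ℕ} {k x : ℕ} :
    x ∈ distinctValues w k ↔ ∃ i < k, w i = some x := by
  induction k with
  | zero => simp [distinctValues]
  | succ k ih =>
    rw [distinctValues, mem_appendNew, ih]
    constructor
    · rintro (⟨i, hi, h⟩ | h)
      · exact ⟨i, by omega, h⟩
      · exact ⟨k, by omega, h⟩
    · rintro ⟨i, hi, h⟩
      rcases Nat.lt_succ_iff_lt_or_eq.1 hi with hi | rfl
      · exact Or.inl ⟨i, hi, h⟩
      · exact Or.inr h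

theorem nodup_distinctValues (w : ℕ → Option ℕ) (k : ℕ) : (distinctValues w k).Nodup := by
  induction k with
  | zero => exact List.nodup_nil
  | succ k ih => exact nodup_appendNew ih _

/-- New values are only appended, so the position of a value never changes; this is what makes a
position a description. -/
theorem prefix_distinctValues (w : ℕ → Option ℕ) {k l : ℕ} (h : k ≤ l) :
    distinctValues w k <+: distinctValues w l := by
  induction l, h using Nat.le_induction with
  | base => exact List.prefix_rfl
  | succ l _ ih => exact ih.trans (prefix_appendNew _ _)

theorem getElem?_of_prefix {β : Type*} {l₁ l₂ : List β} {i : ℕ} {x : β} (h : l₁ <+: l₂)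
    (hx : l₁[i]? = some x) : l₂[i]? = some x := by
  obtain ⟨t, rfl⟩ := h
  obtain ⟨hi, -⟩ := List.getElem?_eq_some_iff.1 hx
  rwa [List.getElem?_append_left hi]

theorem distinctValues_congr {w w' : ℕ → Option ℕ} {k : ℕ} (h : ∀ i < k, w i = w' i) :
    distinctValues w k = distinctValues w' k := by
  induction k with
  | zero => rfl
  | succ k ih =>
    rw [distinctValues, distinctValues, ih fun i hi => h i (by omega), h k (by omega)]

/-- The distinct events announced by `z` on the proper prefixes of `τ`. -/
def distinctEvents {α : Type*} (z : α → List ℕ → Option ℕ) (a : α) (τ : List ℕ) : List ℕ :=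
  distinctValues (fun i => z a (τ.take i)) τ.length

theorem distinctEvents_oraclePrefix {α : Type*} (A : Set ℕ) (z : α → List ℕ → Option ℕ) (a : α)
    (k : ℕ) : distinctEvents z a (oraclePrefix A k) =
      distinctValues (fun i => z a (oraclePrefix A i)) k := by
  rw [distinctEvents, oraclePrefix_length]
  refine distinctValues_congr fun i hi => ?_
  rw [take_oraclePrefix A hi.le]

variable {α : Type*} [Primcodable α]

theorem computable₂_distinctEvents {z : α → List ℕ → Option ℕ} (hz : Computable₂ z) :
    Computable₂ (distinctEvents z) := by
  refine (Computable.nat_rec (f := fun p : α × List ℕ => p.2.length) (g := fun _ => [])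
    (h := fun p q => appendNew q.2 (z p.1 (p.2.take q.1)))
    (Computable.list_length.comp Computable.snd) (Computable.const []) ?_).of_eq ?_
  · refine primrec₂_appendNew.to_comp.comp (Computable.snd.comp Computable.snd)
      (hz.comp (Computable.fst.comp Computable.fst) (Primrec.list_take.to_comp.comp
      (Computable.fst.comp Computable.snd) (Computable.snd.comp Computable.fst)))
  · rintro ⟨a, τ⟩
    simp only [distinctEvents]
    generalize τ.length = k
    induction k with
    | zero => rfl
    | succ k ih => simp only [distinctValues, ih]

/-- Since all successful stages agree, the value may be chosen from any one of them. -/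
theorem exists_isStaging_of_consistent {σ : Type*} [Primcodable σ] (A : Set ℕ)
    {H : α → List ℕ → Option σ} (hH : Computable₂ H)
    (hc : ∀ a k k' s s', H a (oraclePrefix A k) = some s → H a (oraclePrefix A k') = some s' →
      s = s') : ∃ f : α →. σ, IsStaging A f H := by
  refine ⟨fun a => ⟨∃ s, ∃ k, H a (oraclePrefix A k) = some s, fun h => h.choose⟩, hH,
    fun a s => ⟨?_, fun h => ?_⟩⟩
  · rintro ⟨h, rfl⟩
    exact h.choose_spec
  · refine ⟨⟨s, h⟩, ?_⟩
    obtain ⟨k, hk⟩ := h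
    have hs : ∃ s, ∃ k, H a (oraclePrefix A k) = some s := ⟨s, k, hk⟩
    exact hc a _ _ _ _ hs.choose_spec.choose_spec hk

variable {A : Set ℕ}

/-- An element of a set which is enumerated with the help of the oracle, from `v` and the side
information, is described by its position in the enumeration. -/
theorem IsUniversalMachine.exists_condComplexity_le_of_events {U : Machine}
    (hU : IsUniversalMachine A U) {z : ℕ × ℕ → List ℕ → Option ℕ} (hz : Computable₂ z) :
    ∃ c, ∀ h l v y k s (T : Finset ℕ), z (v, y) (oraclePrefix A k) = some s →
      (∀ k' s', z (v, y) (oraclePrefix A k') = some s' → s' ∈ T) → T.card ≤ 2 ^ l →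
      Nat.pair l v < 2 ^ h → condComplexity U s y ≤ l + 2 * h + c := by
  -- Here `a.1.1` is the header `Nat.pair l v`, `a.1.2` the content, read as a position, and `a.2`
  -- the side information.
  have hH : Computable₂ fun (a : (ℕ × ℕ) × ℕ) (τ : List ℕ) =>
      (distinctEvents z (a.1.1.unpair.2, a.2) τ)[a.1.2]? := by
    have h11 : Computable fun p : ((ℕ × ℕ) × ℕ) × List ℕ => p.1.1 :=
      Computable.fst.comp Computable.fst
    refine Computable.list_getElem?.comp ((computable₂_distinctEvents hz).comp (Computable.pair
      (Computable.snd.comp (Computable.unpair.comp (Computable.fst.comp h11)))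
      (Computable.snd.comp Computable.fst)) Computable.snd) (Computable.snd.comp h11)
  obtain ⟨f, hf⟩ := exists_isStaging_of_consistent A hH (by
    intro a k k' s s' h h'
    rw [distinctEvents_oraclePrefix] at h h'
    rcases le_total k k' with hk | hk
    · exact Option.some.inj ((getElem?_of_prefix (prefix_distinctValues _ hk) h).symm.trans h')
    · exact Option.some.inj (h.symm.trans (getElem?_of_prefix (prefix_distinctValues _ hk) h')))
  obtain ⟨c, hc⟩ := hU.exists_condComplexity_le hf
  refine ⟨c, fun h l v y k s T hs hT hcard hv => ?_⟩
  have hmem : s ∈ distinctValues (fun i => z (v, y) (oraclePrefix A i)) (k + 1) :=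
    mem_distinctValues.2 ⟨k, by omega, hs⟩
  obtain ⟨m, hm, hms⟩ := List.getElem_of_mem hmem
  have hlen : (distinctValues (fun i => z (v, y) (oraclePrefix A i)) (k + 1)).length ≤ T.card := by
    rw [← List.toFinset_card_of_nodup (nodup_distinctValues _ _)]
    refine Finset.card_le_card fun x hx => ?_
    obtain ⟨i, -, hi⟩ := mem_distinctValues.1 (List.mem_toFinset.1 hx)
    exact hT i x hi
  refine (hc h l v m y s hv (by omega) ((hf.mem_iff _ _).2 ⟨k + 1, ?_⟩)).1
  rw [distinctEvents_oraclePrefix, Nat.unpair_pair]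
  exact List.getElem?_eq_some_iff.2 ⟨hm, hms⟩

/-- The numbers of the form `g (v, i)` are announced as a sequence of events. -/
theorem exists_events {g : ℕ × ℕ →. ℕ} {H : ℕ × ℕ → List ℕ → Option ℕ} (hg : IsStaging A g H) :
    ∃ z : ℕ → List ℕ → Option ℕ, Computable₂ z ∧
      ∀ v w, (∃ k, z v (oraclePrefix A k) = some w) ↔ ∃ i, w ∈ g (v, i) := by
  -- Dovetailing: the stage number codes an index `i` together with a stage for `g (v, i)`.
  refine ⟨fun v τ => H (v, τ.length.unpair.1) (τ.take τ.length.unpair.2), ?_, fun v w => ?_⟩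
  · have hl : Primrec fun p : ℕ × List ℕ => p.2.length.unpair :=
      Primrec.unpair.comp (Primrec.list_length.comp Primrec.snd)
    exact hg.computable.comp (Computable.pair Computable.fst (Primrec.fst.comp hl).to_comp)
      (Primrec.list_take.comp (Primrec.snd.comp hl) Primrec.snd).to_comp
  · simp only [oraclePrefix_length, hg.mem_iff]
    constructor
    · rintro ⟨k, hk⟩
      rw [take_oraclePrefix A (Nat.unpair_right_le k)] at hk
      exact ⟨_, _, hk⟩
    · rintro ⟨i, k, hk⟩
      refine ⟨Nat.pair i k, ?_⟩
      simp only [Nat.unpair_pair]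
      rw [take_oraclePrefix A (Nat.right_le_pair i k)]
      exact hk

theorem pair_lt_two_pow {a b g : ℕ} (ha : a < 2 ^ g) (hb : b < 2 ^ g) :
    Nat.pair a b < 2 ^ (2 * g) := by
  refine (Nat.pair_lt_max_add_one_sq a b).trans_le ?_
  rw [mul_comm, pow_mul]
  exact Nat.pow_le_pow_left (by have := max_lt ha hb; omega) 2

/-- If the pair `(P, Q)` belongs to a set with at most `2 ^ k` elements which is enumerated with
the help of the oracle from `v`, then the complexity of `P` and the complexity of `Q` given `P` add
up to at most `k`, up to a logarithmic term. -/
theorem IsUniversalMachine.exists_complexity_add_condComplexity_le {U : Machine}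
    (hU : IsUniversalMachine A U) {z : ℕ → List ℕ → Option ℕ} (hz : Computable₂ z) :
    ∃ c, ∀ g v k P Q (T : Finset ℕ), v < 2 ^ g → k + 1 < 2 ^ g →
      (∃ i, z v (oraclePrefix A i) = some (Nat.pair P Q)) →
      (∀ i w, z v (oraclePrefix A i) = some w → w ∈ T) → T.card ≤ 2 ^ k →
      complexity U P + condComplexity U Q P ≤ k + 16 * g + c := by
  -- Given `P` as side information, this announces the second entries of the pairs that start with
  -- `P`.
  have hzQ : Computable₂ fun (a : ℕ × ℕ) (τ : List ℕ) => (z a.1 τ).bind fun w =>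
      bif decide (w.unpair.1 = a.2) then some w.unpair.2 else none := by
    refine Computable.option_bind (hz.comp (Computable.fst.comp Computable.fst) Computable.snd)
      (Computable.cond (Primrec.to_comp ?_) (Primrec.to_comp ?_) (Computable.const none))
    · exact Primrec.eq.decide.comp (Primrec.fst.comp (Primrec.unpair.comp Primrec.snd))
        (Primrec.snd.comp (Primrec.fst.comp Primrec.fst))
    · exact Primrec.option_some.comp (Primrec.snd.comp (Primrec.unpair.comp Primrec.snd))
  -- With parameter `Nat.pair v j`, this announces a first entry once `2 ^ j` pairs with that entry
  -- have appeared. The current pair is appended because `distinctEvents` looks only at proper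
  -- prefixes.
  have hzP : Computable₂ fun (a : ℕ × ℕ) (τ : List ℕ) => (z a.1.unpair.1 τ).bind fun w =>
      bif decide (2 ^ a.1.unpair.2 ≤ ((appendNew (distinctEvents z a.1.unpair.1 τ) (some w)).filter
        fun x => decide (x.unpair.1 = w.unpair.1)).length) then some w.unpair.1 else none := by
    have hv : Computable fun p : (ℕ × ℕ) × List ℕ => p.1.1.unpair.1 :=
      Computable.fst.comp (Computable.unpair.comp (Computable.fst.comp Computable.fst))
    refine Computable.option_bind (hz.comp hv Computable.snd)
      (Computable.cond (Primrec.nat_le.decide.to_comp.comp ?_ (Computable.list_length.comp ?_))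
      (Primrec.to_comp ?_) (Computable.const none))
    · exact primrec₂_pow.to_comp.comp (Computable.const 2) (Computable.snd.comp
        (Computable.unpair.comp (Computable.fst.comp (Computable.fst.comp Computable.fst))))
    · have hR : PrimrecRel fun x w : ℕ => x.unpair.1 = w.unpair.1 :=
        Primrec.eq.comp (Primrec.fst.comp (Primrec.unpair.comp Primrec.fst))
          (Primrec.fst.comp (Primrec.unpair.comp Primrec.snd))
      exact hR.listFilter.to_comp.comp (primrec₂_appendNew.to_comp.comp
        ((computable₂_distinctEvents hz).comp (hv.comp Computable.fst)
          (Computable.snd.comp Computable.fst)) (Computable.option_some.comp Computable.snd))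
        Computable.snd
    · exact Primrec.option_some.comp (Primrec.fst.comp (Primrec.unpair.comp Primrec.snd))
  obtain ⟨c₁, hc₁⟩ := hU.exists_condComplexity_le_of_events hzQ
  obtain ⟨c₂, hc₂⟩ := hU.exists_condComplexity_le_of_events hzP
  refine ⟨c₁ + c₂ + 1, fun g v k P Q T hvg hkg hPQ hT hcard => ?_⟩
  classical
  obtain ⟨w₀, hw₀⟩ := hPQ
  set W := T.filter fun w => ∃ i, z v (oraclePrefix A i) = some w with hW
  have hWcard : W.card ≤ 2 ^ k := (Finset.card_filter_le _ _).trans hcard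
  have hWmem : ∀ w, w ∈ W ↔ ∃ i, z v (oraclePrefix A i) = some w := by
    intro w
    rw [hW, Finset.mem_filter]
    exact ⟨And.right, fun h => ⟨h.elim fun i hi => hT i w hi, h⟩⟩
  set fiber : ℕ → Finset ℕ := fun p => W.filter fun w => w.unpair.1 = p with hfib
  have hPfib : Nat.pair P Q ∈ fiber P := by
    simp only [hfib, Finset.mem_filter, hWmem, Nat.unpair_pair, and_true]
    exact ⟨w₀, hw₀⟩
  have hpos : (fiber P).card ≠ 0 := Finset.card_ne_zero_of_mem hPfib
  -- Rounding the logarithm down costs one bit for `Q`; this is the `+ 1` in the final constant.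
  set j := Nat.log 2 (fiber P).card with hj
  have hj1 : 2 ^ j ≤ (fiber P).card := Nat.pow_log_le_self 2 hpos
  have hj2 : (fiber P).card < 2 ^ (j + 1) := Nat.lt_pow_succ_log_self (by norm_num) _
  have hjk : j ≤ k := by
    refine (Nat.pow_le_pow_iff_right (a := 2) (by norm_num)).1 (hj1.trans (le_trans ?_ hWcard))
    exact Finset.card_filter_le _ _
  have e0 : ∀ {a}, a < 2 ^ g → a < 2 ^ (2 * g) := fun h =>
    h.trans_le (Nat.pow_le_pow_right (by norm_num) (by omega))
  have hQ : condComplexity U Q P ≤ (j + 1) + 2 * (4 * g) + c₁ := by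
    refine hc₁ (4 * g) (j + 1) v P w₀ Q ((fiber P).image fun w => w.unpair.2) ?_ ?_ ?_ ?_
    · simp [hw₀]
    · intro i s hs
      simp only [Option.bind_eq_some_iff, Bool.cond_decide] at hs
      obtain ⟨w, hw, hs⟩ := hs
      by_cases hwP : w.unpair.1 = P
      · simp only [hwP, if_true, Option.some.injEq] at hs
        refine Finset.mem_image.2 ⟨w, Finset.mem_filter.2 ⟨(hWmem w).2 ⟨i, hw⟩, hwP⟩, hs⟩
      · simp [hwP] at hs
    · exact Finset.card_image_le.trans hj2.le
    · rw [show 4 * g = 2 * (2 * g) by ring]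
      exact pair_lt_two_pow (e0 (by omega)) (e0 hvg)
  have hseq : ∀ i w, z v (oraclePrefix A i) = some w →
      appendNew (distinctEvents z v (oraclePrefix A i)) (some w) =
        distinctValues (fun i => z v (oraclePrefix A i)) (i + 1) := by
    intro i w hw
    rw [distinctEvents_oraclePrefix, distinctValues, hw]
  have hfl : ∀ i w, z v (oraclePrefix A i) = some w →
      ((appendNew (distinctEvents z v (oraclePrefix A i)) (some w)).filter
        fun x => decide (x.unpair.1 = w.unpair.1)).length =
      ((distinctValues (fun i => z v (oraclePrefix A i)) (i + 1)).toFinset.filter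
        fun x => x.unpair.1 = w.unpair.1).card := by
    intro i w hw
    rw [hseq i w hw, ← List.toFinset_card_of_nodup ((nodup_distinctValues _ _).filter _),
      List.toFinset_filter]
    simp
  have hP : condComplexity U P 0 ≤ (k - j) + 2 * (4 * g) + c₂ := by
    obtain ⟨i, hi⟩ : ∃ i, ∀ w ∈ fiber P,
        w ∈ distinctValues (fun i => z v (oraclePrefix A i)) i := by
      have : ∀ᶠ i in atTop, ∀ w ∈ fiber P,
          w ∈ distinctValues (fun i => z v (oraclePrefix A i)) i := by
        rw [Filter.eventually_all_finset]
        intro w hw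
        obtain ⟨i, hi⟩ := (hWmem w).1 (Finset.mem_filter.1 hw).1
        filter_upwards [eventually_gt_atTop i] with i' hi'
        exact mem_distinctValues.2 ⟨i, hi', hi⟩
      exact this.exists
    -- The stage at which the last pair of the fiber over `P` appears: the event there lies in the
    -- fiber itself, so the threshold test is made for `P` when the count is complete.
    obtain ⟨i, w, hwi, hwP, hi⟩ : ∃ i w, z v (oraclePrefix A i) = some w ∧ w.unpair.1 = P ∧
        ∀ w ∈ fiber P, w ∈ distinctValues (fun i => z v (oraclePrefix A i)) (i + 1) := by
      have hex : ∃ i, ∀ w ∈ fiber P,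
        w ∈ distinctValues (fun i => z v (oraclePrefix A i)) i := ⟨i, hi⟩
      rcases hn : Nat.find hex with _ | n
      · have := Nat.find_spec hex _ hPfib
        rw [hn] at this
        simp [distinctValues] at this
      · have h1 := Nat.find_spec hex
        rw [hn] at h1
        have h2 := Nat.find_min hex (m := n) (by omega)
        push Not at h2
        obtain ⟨w, hw, hwn⟩ := h2
        refine ⟨n, w, ?_, (Finset.mem_filter.1 hw).2, h1⟩
        have := h1 w hw
        rw [distinctValues, mem_appendNew] at this
        exact this.resolve_left hwn
    refine hc₂ (4 * g) (k - j) (Nat.pair v j) 0 i P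
      ((W.image fun w => w.unpair.1).filter fun p => 2 ^ j ≤ (fiber p).card) ?_ ?_ ?_ ?_
    · simp only [Nat.unpair_pair, hwi, Option.bind_some, Bool.cond_decide]
      rw [hfl i w hwi, hwP, if_pos]
      refine hj1.trans (Finset.card_le_card fun x hx => ?_)
      exact Finset.mem_filter.2 ⟨List.mem_toFinset.2 (hi x hx), (Finset.mem_filter.1 hx).2⟩
    · intro i' s hs
      simp only [Nat.unpair_pair, Option.bind_eq_some_iff, Bool.cond_decide] at hs
      obtain ⟨w, hw, hs⟩ := hs
      rw [hfl i' w hw] at hs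
      split_ifs at hs with hle
      · simp only [Option.some.injEq] at hs
        subst hs
        refine Finset.mem_filter.2 ⟨Finset.mem_image.2 ⟨w, (hWmem w).2 ⟨i', hw⟩, rfl⟩,
          hle.trans (Finset.card_le_card fun x hx => ?_)⟩
        rw [Finset.mem_filter, List.mem_toFinset, mem_distinctValues] at hx
        obtain ⟨⟨i, -, hi⟩, hx⟩ := hx
        exact Finset.mem_filter.2 ⟨(hWmem x).2 ⟨i, hi⟩, hx⟩
    · set R := (W.image fun w => w.unpair.1).filter fun p => 2 ^ j ≤ (fiber p).card
      -- The fibers over distinct first entries are disjoint, and those over `R` have at least `2 ^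
      -- j` elements each.
      have hsum : R.card * 2 ^ j ≤ 2 ^ k := by
        calc R.card * 2 ^ j ≤ ∑ p ∈ R, (fiber p).card := by
              rw [← smul_eq_mul]
              exact Finset.card_nsmul_le_sum _ _ _ fun p hp => (Finset.mem_filter.1 hp).2
          _ ≤ ∑ p ∈ W.image fun w => w.unpair.1, (fiber p).card :=
              Finset.sum_le_sum_of_subset (Finset.filter_subset _ _)
          _ = W.card := (Finset.card_eq_sum_card_image _ _).symm
          _ ≤ 2 ^ k := hWcard
      refine Nat.le_of_mul_le_mul_right ?_ (Nat.two_pow_pos j)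
      rwa [← pow_add, Nat.sub_add_cancel hjk]
    · rw [show 4 * g = 2 * (2 * g) by ring]
      exact pair_lt_two_pow (e0 (by omega)) (pair_lt_two_pow hvg (by omega))
  unfold complexity
  omega

end Kakeya

/-! ### Primitive recursiveness of integer arithmetic -/

namespace Kakeya

/-- The parity of the code of an integer is its sign, so the positive and negative parts can be read
off; the integer operations below reduce to these two natural numbers. -/
theorem encode_ofNat_int (a : ℕ) : Encodable.encode (a : ℤ) = 2 * a := by
  rfl

theorem encode_negSucc_int (a : ℕ) : Encodable.encode (Int.negSucc a) = 2 * a + 1 := by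
  rfl

theorem primrec_int_toNat : Primrec Int.toNat := by
  refine (Primrec.cond (c := fun x : ℤ => decide (Encodable.encode x % 2 = 0))
    (f := fun x : ℤ => Encodable.encode x / 2) (g := fun _ => 0) ?_ ?_ (Primrec.const 0)).of_eq ?_
  · exact Primrec.eq.decide.comp (Primrec.nat_mod.comp Primrec.encode (Primrec.const 2))
      (Primrec.const 0)
  · exact Primrec.nat_div.comp Primrec.encode (Primrec.const 2)
  · rintro (a | a)
    · have := encode_ofNat_int a
      simp only [Int.ofNat_eq_natCast, this, Int.toNat_natCast]
      simp
    · simp [encode_negSucc_int, Nat.add_mod]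

theorem primrec_int_neg_toNat : Primrec fun x : ℤ => (-x).toNat := by
  refine (Primrec.cond (c := fun x : ℤ => decide (Encodable.encode x % 2 = 0))
    (f := fun _ => 0) (g := fun x : ℤ => Encodable.encode x / 2 + 1) ?_ (Primrec.const 0) ?_).of_eq
    ?_
  · exact Primrec.eq.decide.comp (Primrec.nat_mod.comp Primrec.encode (Primrec.const 2))
      (Primrec.const 0)
  · exact Primrec.succ.comp (Primrec.nat_div.comp Primrec.encode (Primrec.const 2))
  · rintro (a | a)
    · have := encode_ofNat_int a
      simp only [Int.ofNat_eq_natCast, this]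
      simp
    · simp only [encode_negSucc_int, Int.neg_negSucc]
      have h1 : (2 * a + 1) % 2 = 1 := by omega
      have h2 : (2 * a + 1) / 2 = a := by omega
      rw [h1, h2]
      simp

theorem primrec_int_subNatNat : Primrec₂ fun a b : ℕ => (a : ℤ) - b := by
  refine Primrec₂.encode_iff.1 ((Primrec.cond (c := fun p : ℕ × ℕ => decide (p.2 ≤ p.1))
    (f := fun p => 2 * (p.1 - p.2)) (g := fun p => 2 * (p.2 - p.1 - 1) + 1) ?_ ?_ ?_).of_eq ?_)
  · exact Primrec.nat_le.decide.comp Primrec.snd Primrec.fst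
  · exact Primrec.nat_mul.comp (Primrec.const 2) (Primrec.nat_sub.comp Primrec.fst Primrec.snd)
  · exact Primrec.succ.comp (Primrec.nat_mul.comp (Primrec.const 2) (Primrec.nat_sub.comp
      (Primrec.nat_sub.comp Primrec.snd Primrec.fst) (Primrec.const 1)))
  · rintro ⟨a, b⟩
    by_cases h : b ≤ a
    · have : (a : ℤ) - b = ((a - b : ℕ) : ℤ) := by omega
      simp only [this, encode_ofNat_int, h, decide_true, cond_true]
    · have : (a : ℤ) - b = Int.negSucc (b - a - 1) := by omega
      simp only [this, encode_negSucc_int, h]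
      simp

theorem primrec_int_sub : Primrec₂ fun x y : ℤ => x - y := by
  refine (primrec_int_subNatNat.comp
    (Primrec.nat_add.comp (primrec_int_toNat.comp Primrec.fst)
      (primrec_int_neg_toNat.comp Primrec.snd))
    (Primrec.nat_add.comp (primrec_int_neg_toNat.comp Primrec.fst)
      (primrec_int_toNat.comp Primrec.snd))).of_eq ?_
  rintro ⟨x, y⟩
  simp only
  omega

theorem primrec_int_natAbs : Primrec Int.natAbs := by
  refine (Primrec.nat_add.comp primrec_int_toNat primrec_int_neg_toNat).of_eq fun x => ?_
  omega

theorem primrec_int_natMul : Primrec₂ fun (a : ℕ) (x : ℤ) => (a : ℤ) * x := by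
  refine (primrec_int_subNatNat.comp
    (Primrec.nat_mul.comp Primrec.fst (primrec_int_toNat.comp Primrec.snd))
    (Primrec.nat_mul.comp Primrec.fst (primrec_int_neg_toNat.comp Primrec.snd))).of_eq ?_
  rintro ⟨a, x⟩
  simp only
  push_cast
  rw [← mul_sub]
  congr 1
  omega

theorem primrec_int_ofNat : Primrec fun a : ℕ => (a : ℤ) :=
  (primrec_int_subNatNat.comp Primrec.id (Primrec.const 0)).of_eq fun a => by simp

theorem primrec_list_all {α ι : Type*} [Primcodable α] {b : ι → α → Bool}
    (hb : ∀ i, Primrec (b i)) (l : List ι) : Primrec fun a => l.all fun i => b i a := by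
  induction l with
  | nil => exact Primrec.const true
  | cons i l ih => exact (Primrec.and.comp (hb i) ih).of_eq fun a => by simp

theorem computable_list_all {α ι : Type*} [Primcodable α] {b : ι → α → Bool}
    (hb : ∀ i, Computable (b i)) (l : List ι) : Computable fun a => l.all fun i => b i a := by
  induction l with
  | nil => exact Computable.const true
  | cons i l ih => exact (Primrec.and.to_comp.comp (hb i) ih).of_eq fun a => by simp

theorem primrec_list_sum {α ι : Type*} [Primcodable α] {b : ι → α → ℕ}
    (hb : ∀ i, Primrec (b i)) (l : List ι) : Primrec fun a => (l.map fun i => b i a).sum := by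
  induction l with
  | nil => exact Primrec.const 0
  | cons i l ih => exact (Primrec.nat_add.comp (hb i) ih).of_eq fun a => by simp

theorem primrec_eval_fin {α : Type*} [Primcodable α] {n : ℕ} (i : Fin n) :
    Primrec fun p : Fin n → α => p i :=
  Primrec.fin_app.comp Primrec.id (Primrec.const i)

theorem primrec_list_ofFn {α : Type*} [Primcodable α] (n : ℕ) :
    Primrec fun p : Fin n → α => List.ofFn p :=
  Primrec.list_ofFn fun i => primrec_eval_fin i

/-! ### Complexity of integer vectors and transfer along a computable relation -/

variable {A : Set ℕ}

/-- An integer vector with entries of absolute value at most `2 ^ v` has complexity at most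
`(v + 2) * n`, up to a logarithmic term. -/
theorem IsUniversalMachine.exists_complexity_vector_le {U : Machine}
    (hU : IsUniversalMachine A U) (n : ℕ) :
    ∃ c, ∀ g v (p : Fin n → ℤ), (∀ i, (p i).natAbs ≤ 2 ^ v) → v < 2 ^ g → (v + 2) * n < 2 ^ g →
      complexity U (Encodable.encode (List.ofFn p)) ≤ (v + 2) * n + 4 * g + c := by
  -- The enumeration ignores the answers of the oracle: the stage number is decoded as a candidate
  -- vector. Each entry has `2 * 2 ^ v + 1 ≤ 2 ^ (v + 2)` possible values.
  have hz : Computable₂ fun (a : ℕ × ℕ) (τ : List ℕ) =>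
      (@Encodable.decode (Fin n → ℤ) Primcodable.toEncodable τ.length).bind fun p =>
        bif (List.finRange n).all fun i => decide ((p i).natAbs ≤ 2 ^ a.1) then
          some (Encodable.encode (List.ofFn p)) else none := by
    refine Primrec.to_comp (Primrec.option_bind (Primrec.decode.comp (Primrec.list_length.comp
      Primrec.snd)) (Primrec.cond (primrec_list_all (fun i => ?_) _) ?_ (Primrec.const none)))
    · exact Primrec.nat_le.decide.comp (primrec_int_natAbs.comp
        ((primrec_eval_fin i).comp Primrec.snd)) (primrec₂_pow.comp (Primrec.const 2)
        (Primrec.fst.comp (Primrec.fst.comp Primrec.fst)))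
    · exact Primrec.option_some.comp (Primrec.encode.comp ((primrec_list_ofFn n).comp Primrec.snd))
  obtain ⟨c, hc⟩ := hU.exists_condComplexity_le_of_events hz
  refine ⟨c, fun g v p hp hv hl => ?_⟩
  have := hc (2 * g) ((v + 2) * n) v 0
    (@Encodable.encode (Fin n → ℤ) Primcodable.toEncodable p) (Encodable.encode (List.ofFn p))
    ((Fintype.piFinset fun _ : Fin n => Finset.Icc (-2 ^ v : ℤ) (2 ^ v)).image
      fun p => Encodable.encode (List.ofFn p)) ?_ ?_ ?_ (pair_lt_two_pow hl hv)
  · unfold complexity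
    omega
  · have hall : ((List.finRange n).all fun i => decide ((p i).natAbs ≤ 2 ^ v)) = true := by
      simp [hp]
    rw [oraclePrefix_length, @Encodable.encodek (Fin n → ℤ) Primcodable.toEncodable, Option.bind_some, hall, cond_true]
  · intro k s hs
    rw [oraclePrefix_length, Option.bind_eq_some_iff] at hs
    obtain ⟨q, -, hq⟩ := hs
    rw [Bool.cond_eq_ite] at hq
    split_ifs at hq with hb
    simp only [List.all_eq_true, List.mem_finRange, decide_eq_true_eq, true_imp_iff] at hb
    refine Finset.mem_image.2 ⟨q, Fintype.mem_piFinset.2 fun i => Finset.mem_Icc.2 ?_,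
      Option.some.inj hq⟩
    have := hb i
    zify at this
    exact abs_le.1 this
  · refine Finset.card_image_le.trans ?_
    rw [Fintype.card_piFinset, Finset.prod_const, pow_mul, Finset.card_univ, Fintype.card_fin]
    refine Nat.pow_le_pow_left ?_ n
    have h1 : 1 ≤ 2 ^ v := Nat.one_le_two_pow
    rw [Int.card_Icc, pow_add]
    have : ((2 : ℤ) ^ v) = ((2 ^ v : ℕ) : ℤ) := by push_cast; rfl
    rw [this]
    omega

/-- Suppose that, at each precision `r`, every `X` is related to a bounded number of pairs `(P, Q)`
by a relation which is the projection of a computable one. If `X` is related to `(P, Q)` then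
`K(P) + K(Q ∣ P) ≤ K(X)`, up to a logarithmic term. -/
theorem IsUniversalMachine.exists_complexity_add_le_of_relation {U : Machine}
    (hU : IsUniversalMachine A U) {γ : Type*} [Primcodable γ] {R : ℕ → γ → Bool}
    (hR : Computable₂ R) {fX fP fQ : γ → ℕ} (hX : Computable fX) (hP : Computable fP)
    (hQ : Computable fQ) (d : ℕ)
    (hcount : ∀ r X, ∃ T : Finset ℕ, T.card ≤ 2 ^ d ∧
      ∀ w, R r w = true → fX w = X → Nat.pair (fP w) (fQ w) ∈ T) :
    ∃ c, ∀ g r w, R r w = true → r < 2 ^ g → complexity U (fX w) + d + 1 < 2 ^ g →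
      complexity U (fP w) + condComplexity U (fQ w) (fP w) ≤
        complexity U (fX w) + 32 * g + c := by
  obtain ⟨HU, hHU⟩ := exists_isStaging A hU.isPrefixMachine.recursiveIn
  -- The parameter `a.1` codes the precision and a program length; the index `a.2` codes a program
  -- with a candidate witness, accepted if the program outputs the `X` of the witness.
  have hH : Computable₂ fun (a : ℕ × ℕ) (τ : List ℕ) =>
      (Encodable.decode (α := List Bool × γ) a.2).bind fun w =>
        (HU (w.1, 0) τ).bind fun X =>
          bif (R a.1.unpair.1 w.2 && decide (w.1.length = a.1.unpair.2)) && decide (fX w.2 = X) then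
            some (Nat.pair (fP w.2) (fQ w.2)) else none := by
    refine Computable.option_bind (Computable.decode.comp (Computable.snd.comp Computable.fst)) ?_
    refine Computable.option_bind (hHU.computable.comp (Computable.pair (Computable.fst.comp
      Computable.snd) (Computable.const 0)) (Computable.snd.comp Computable.fst)) ?_
    have hv : Computable fun q : (((ℕ × ℕ) × List ℕ) × List Bool × γ) × ℕ => q.1.1.1.1.unpair :=
      Computable.unpair.comp (Computable.fst.comp (Computable.fst.comp (Computable.fst.comp
        Computable.fst)))
    have hw : Computable fun q : (((ℕ × ℕ) × List ℕ) × List Bool × γ) × ℕ => q.1.2 :=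
      Computable.snd.comp Computable.fst
    refine Computable.cond (Primrec.and.to_comp.comp (Primrec.and.to_comp.comp
      (hR.comp (Computable.fst.comp hv) (Computable.snd.comp hw))
      (Primrec.eq.decide.to_comp.comp (Computable.list_length.comp (Computable.fst.comp hw))
        (Computable.snd.comp hv)))
      (Primrec.eq.decide.to_comp.comp (hX.comp (Computable.snd.comp hw)) Computable.snd))
      (Computable.option_some.comp (Primrec₂.natPair.to_comp.comp (hP.comp (Computable.snd.comp hw))
        (hQ.comp (Computable.snd.comp hw)))) (Computable.const none)
  have hHmem : ∀ a k s, ((Encodable.decode (α := List Bool × γ) a.2).bind fun w =>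
        (HU (w.1, 0) (oraclePrefix A k)).bind fun X =>
          bif (R a.1.unpair.1 w.2 && decide (w.1.length = a.1.unpair.2)) && decide (fX w.2 = X) then
            some (Nat.pair (fP w.2) (fQ w.2)) else none) = some s ↔
      ∃ w : List Bool × γ, Encodable.decode (a : ℕ × ℕ).2 = some w ∧
        HU (w.1, 0) (oraclePrefix A k) = some (fX w.2) ∧ R a.1.unpair.1 w.2 = true ∧
        w.1.length = a.1.unpair.2 ∧ Nat.pair (fP w.2) (fQ w.2) = s := by
    intro a k s
    simp only [Option.bind_eq_some_iff, Bool.cond_eq_ite, Bool.and_eq_true, decide_eq_true_eq]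
    constructor
    · rintro ⟨w, hw, X, hX, h⟩
      split_ifs at h with hc
      exact ⟨w, hw, hc.2 ▸ hX, hc.1.1, hc.1.2, Option.some.inj h⟩
    · rintro ⟨w, hw, hX, h1, h2, rfl⟩
      exact ⟨w, hw, _, hX, by simp [h1, h2]⟩
  obtain ⟨f, hf⟩ := exists_isStaging_of_consistent A hH (by
    intro a k k' s s' h h'
    obtain ⟨w, hw, -, -, -, rfl⟩ := (hHmem a k s).1 h
    obtain ⟨w', hw', -, -, -, rfl⟩ := (hHmem a k' s').1 h'
    rw [Option.some.inj (hw.symm.trans hw')])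
  obtain ⟨z, hz, hzmem⟩ := exists_events hf
  obtain ⟨c, hc⟩ := hU.exists_complexity_add_condComplexity_le hz
  refine ⟨c + d, fun g r w hRw hr hk => ?_⟩
  have hzf : ∀ v s, (∃ i, z v (oraclePrefix A i) = some s) ↔ ∃ w : List Bool × γ,
      fX w.2 ∈ U (w.1, 0) ∧ R v.unpair.1 w.2 = true ∧
        w.1.length = v.unpair.2 ∧ Nat.pair (fP w.2) (fQ w.2) = s := by
    intro v s
    rw [hzmem]
    constructor
    · rintro ⟨i, hi⟩
      obtain ⟨k, hk⟩ := (hf.mem_iff _ _).1 hi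
      obtain ⟨w, -, h1, h2⟩ := (hHmem _ _ _).1 hk
      exact ⟨w, (hHU.mem_iff _ _).2 ⟨k, h1⟩, h2⟩
    · rintro ⟨w, h1, h2⟩
      obtain ⟨k, hk⟩ := (hHU.mem_iff _ _).1 h1
      exact ⟨Encodable.encode w, (hf.mem_iff _ _).2 ⟨k, (hHmem _ _ _).2
        ⟨w, Encodable.encodek w, hk, h2⟩⟩⟩
  set k := complexity U (fX w) with hkdef
  choose T hTcard hT using hcount r
  classical
  -- There are `2 ^ k` programs of length `k`, each contributing the at most `2 ^ d` pairs linked to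
  -- its output. Only the cardinality of `T'` matters, so it need not be computable.
  let T' : Finset ℕ := (Finset.univ : Finset (List.Vector Bool k)).biUnion fun p =>
    if h : (U (p.1, 0)).Dom then T ((U (p.1, 0)).get h) else ∅
  have hT'card : T'.card ≤ 2 ^ (k + d) := by
    refine (Finset.card_biUnion_le_card_mul _ _ (2 ^ d) fun p _ => ?_).trans ?_
    · split_ifs
      · exact hTcard _
      · simp
    · rw [Finset.card_univ, card_vector, Fintype.card_bool, pow_add]
  have hpow : (2 : ℕ) ^ g ≤ 2 ^ (2 * g) := Nat.pow_le_pow_right (by norm_num) (by omega)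
  obtain ⟨p, hpl, hp⟩ := hU.exists_program (fX w) 0
  have := hc (2 * g) (Nat.pair r k) (k + d) (fP w) (fQ w) T' (pair_lt_two_pow hr (by omega))
    (by omega) ((hzf _ _).2 ⟨(p, w), hp, by simpa using hRw, by rw [Nat.unpair_pair]; exact hpl, rfl⟩) ?_ hT'card
  · omega
  · intro i s hs
    obtain ⟨⟨p, w⟩, h1, h2, h3, rfl⟩ := (hzf _ _).1 ⟨i, hs⟩
    simp only [Nat.unpair_pair] at h1 h2 h3 ⊢
    refine Finset.mem_biUnion.2 ⟨⟨p, h3⟩, Finset.mem_univ _, ?_⟩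
    have hdom : (U (p, 0)).Dom := Part.dom_iff_mem.2 ⟨_, h1⟩
    rw [dif_pos hdom]
    exact hT _ w h2 (Part.mem_unique h1 (Part.get_mem hdom))

end Kakeya

/-! ### The computable test relating image points to parameters -/

namespace Kakeya

variable {n : ℕ}

theorem norm_le_of_forall_abs_le (v : EuclideanSpace ℝ (Fin n)) {c : ℝ} (hc : 0 ≤ c)
    (h : ∀ i, |v i| ≤ c) : ‖v‖ ≤ n * c := by
  rw [EuclideanSpace.norm_eq]
  refine Real.sqrt_le_iff.2 ⟨by positivity, ?_⟩
  calc ∑ i, ‖v i‖ ^ 2 ≤ ∑ _i : Fin n, c ^ 2 := by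
        refine Finset.sum_le_sum fun i _ => ?_
        rw [Real.norm_eq_abs]
        exact pow_le_pow_left₀ (abs_nonneg _) (h i) 2
    _ = n * c ^ 2 := by simp
    _ ≤ (n * c) ^ 2 := by
        rw [mul_pow]
        refine mul_le_mul_of_nonneg_right ?_ (sq_nonneg c)
        rcases Nat.eq_zero_or_pos n with h0 | h0
        · simp [h0]
        · exact le_self_pow₀ (by exact_mod_cast h0) (by norm_num)

theorem abs_apply_le_norm (v : EuclideanSpace ℝ (Fin n)) (i : Fin n) : |v i| ≤ ‖v‖ := by
  rw [EuclideanSpace.norm_eq, ← Real.norm_eq_abs]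
  refine Real.le_sqrt_of_sq_le ?_
  exact Finset.single_le_sum (f := fun i => ‖v i‖ ^ 2) (fun i _ => sq_nonneg _) (Finset.mem_univ i)

theorem mem_sphere_iff_sum_sq (v : EuclideanSpace ℝ (Fin n)) :
    v ∈ Metric.sphere (0 : EuclideanSpace ℝ (Fin n)) 1 ↔ ∑ i, v i ^ 2 = 1 := by
  rw [mem_sphere_zero_iff_norm, EuclideanSpace.norm_eq, Real.sqrt_eq_one]
  simp

/-- The cube with center `p` and side length `2` meets the sphere of radius `√N`. -/
theorem exists_mem_cube_sum_sq_eq {p : Fin n → ℤ} {N : ℕ}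
    (h1 : N ≤ ∑ i, ((p i).natAbs + 1) ^ 2) (h2 : ∑ i, ((p i).natAbs - 1) ^ 2 ≤ N) :
    ∃ y : Fin n → ℝ, (∀ i, |(p i : ℝ) - y i| ≤ 1) ∧ ∑ i, y i ^ 2 = N := by
  let σ : Fin n → ℝ := fun i => if 0 ≤ p i then 1 else -1
  have hσ2 : ∀ i, σ i ^ 2 = 1 := fun i => by by_cases h : 0 ≤ p i <;> simp [σ, h]
  have hσ1 : ∀ i, |σ i| = 1 := fun i => by by_cases h : 0 ≤ p i <;> simp [σ, h]
  have hσ : ∀ i, (p i : ℝ) = σ i * ((p i).natAbs : ℝ) := by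
    intro i
    have hcast : (((p i).natAbs : ℤ) : ℝ) = ((p i).natAbs : ℝ) := by push_cast; simp
    by_cases h : 0 ≤ p i
    · simp only [σ, h, if_true, one_mul]
      rw [← hcast, Int.natAbs_of_nonneg h]
    · simp only [σ, h, if_false]
      rw [← hcast, Int.ofNat_natAbs_of_nonpos (by omega)]
      push_cast; ring
  -- In absolute values, `s` runs from the point of the cube nearest the origin to the farthest one,
  -- and the intermediate value theorem applies. Truncated subtraction gives the correct nearest
  -- coordinate `0` when `p i = 0`.
  let f : ℝ → ℝ := fun s => ∑ i, ((1 - s) * (((p i).natAbs - 1 : ℕ) : ℝ) +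
    s * (((p i).natAbs + 1 : ℕ) : ℝ)) ^ 2
  have hf : Continuous f := by fun_prop
  have hf0 : f 0 ≤ N := by
    simp only [f]
    have : ((∑ i, ((p i).natAbs - 1) ^ 2 : ℕ) : ℝ) ≤ N := by exact_mod_cast h2
    rw [Nat.cast_sum] at this
    simpa only [sub_zero, one_mul, zero_mul, add_zero, Nat.cast_pow] using this
  have hf1 : (N : ℝ) ≤ f 1 := by
    simp only [f]
    have : (N : ℝ) ≤ ((∑ i, ((p i).natAbs + 1) ^ 2 : ℕ) : ℝ) := by exact_mod_cast h1
    rw [Nat.cast_sum] at this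
    simpa only [sub_self, one_mul, zero_mul, zero_add, Nat.cast_pow] using this
  obtain ⟨s, ⟨hs0, hs1⟩, hs⟩ := intermediate_value_Icc (zero_le_one' ℝ) hf.continuousOn
    ⟨hf0, hf1⟩
  refine ⟨fun i => σ i * ((1 - s) * (((p i).natAbs - 1 : ℕ) : ℝ) +
    s * (((p i).natAbs + 1 : ℕ) : ℝ)), fun i => ?_, ?_⟩
  · rw [hσ i, ← mul_sub, abs_mul, hσ1, one_mul, abs_le]
    have e1 : ((((p i).natAbs - 1 : ℕ) : ℝ)) ≤ (p i).natAbs := by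
      exact_mod_cast Nat.sub_le _ _
    have e2 : ((p i).natAbs : ℝ) ≤ (((p i).natAbs - 1 : ℕ) : ℝ) + 1 := by
      exact_mod_cast (by omega : (p i).natAbs ≤ (p i).natAbs - 1 + 1)
    push_cast
    constructor <;> nlinarith
  · rw [← hs]
    refine Finset.sum_congr rfl fun i _ => ?_
    rw [mul_pow, hσ2, one_mul]

/-- Points of the form `(X, (P, Q), (p, q))`: the image point, the parameter to be recovered, and
an approximation of the parameter for the algorithm computing the parametrization. -/
abbrev Candidate (n : ℕ) : Type :=
  (Fin n → ℤ) × ((Fin n → ℤ) × ℤ) × ((Fin n → ℤ) × ℕ)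

/-- The computable test that `p` approximates a point of the sphere and `q` a point of `[0, 1]` at
precision `m r`, that `F` maps `(p, q)` close to `X`, and that `(P, Q)` is close to `(p, q)` after
rescaling. -/
def parameterTest (m : ℕ → ℕ) (F : ((Fin n → ℤ) × ℤ) × ℕ → (Fin n → ℤ)) (C r : ℕ)
    (w : Candidate n) : Bool :=
  (decide (4 ^ m r ≤ ((List.finRange n).map fun i => ((w.2.2.1 i).natAbs + 1) ^ 2).sum) &&
    decide (((List.finRange n).map fun i => ((w.2.2.1 i).natAbs - 1) ^ 2).sum ≤ 4 ^ m r)) &&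
  (decide (w.2.2.2 ≤ 2 ^ m r) &&
    (List.finRange n).all fun i => decide ((F ((w.2.2.1, (w.2.2.2 : ℤ)), r) i - w.1 i).natAbs ≤ 2))
  && (((List.finRange n).all fun i => decide ((((2 ^ m r : ℕ) : ℤ) * w.2.1.1 i -
    ((2 ^ r : ℕ) : ℤ) * w.2.2.1 i).natAbs ≤ C * 2 ^ m r)) &&
    decide ((((2 ^ m r : ℕ) : ℤ) * w.2.1.2 - ((2 ^ r : ℕ) : ℤ) * (w.2.2.2 : ℤ)).natAbs ≤
      C * 2 ^ m r))

theorem parameterTest_iff {m : ℕ → ℕ} {F : ((Fin n → ℤ) × ℤ) × ℕ → (Fin n → ℤ)} {C r : ℕ}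
    {X P p : Fin n → ℤ} {Q : ℤ} {q : ℕ} : parameterTest m F C r (X, (P, Q), (p, q)) = true ↔
      ((4 ^ m r ≤ ∑ i, ((p i).natAbs + 1) ^ 2 ∧ ∑ i, ((p i).natAbs - 1) ^ 2 ≤ 4 ^ m r) ∧
      q ≤ 2 ^ m r ∧ ∀ i, |((F ((p, q), r) i : ℝ) - X i)| ≤ 2) ∧
      (∀ i, |(2 ^ m r * P i - 2 ^ r * p i : ℝ)| ≤ C * 2 ^ m r) ∧
      |(2 ^ m r * Q - 2 ^ r * q : ℝ)| ≤ C * 2 ^ m r := by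
  have key : ∀ (a : ℤ) (b : ℕ), a.natAbs ≤ b ↔ |(a : ℝ)| ≤ (b : ℝ) := by
    intro a b
    rw [← Int.cast_abs, Int.abs_eq_natAbs]
    norm_cast
  simp only [parameterTest, Bool.and_eq_true, decide_eq_true_eq, List.all_eq_true,
    List.mem_finRange, true_imp_iff, ← Fin.sum_univ_def, key]
  push_cast
  rfl

theorem computable₂_parameterTest {m : ℕ → ℕ} {F : ((Fin n → ℤ) × ℤ) × ℕ → (Fin n → ℤ)}
    (hm : Computable m) (hF : Computable F) (C : ℕ) : Computable₂ (parameterTest m F C) := by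
  have hX : Primrec fun x : ℕ × Candidate n => x.2.1 := Primrec.fst.comp Primrec.snd
  have hPQ : Primrec fun x : ℕ × Candidate n => x.2.2.1 :=
    Primrec.fst.comp (Primrec.snd.comp Primrec.snd)
  have hpq : Primrec fun x : ℕ × Candidate n => x.2.2.2 :=
    Primrec.snd.comp (Primrec.snd.comp Primrec.snd)
  have hp : ∀ i, Primrec fun x : ℕ × Candidate n => x.2.2.2.1 i := fun i =>
    (primrec_eval_fin i).comp (Primrec.fst.comp hpq)
  have hq : Primrec fun x : ℕ × Candidate n => x.2.2.2.2 := Primrec.snd.comp hpq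
  have hm' : Computable fun x : ℕ × Candidate n => m x.1 := hm.comp Computable.fst
  have hpow : ∀ b, Computable fun x : ℕ × Candidate n => b ^ m x.1 := fun b =>
    primrec₂_pow.to_comp.comp (Computable.const b) hm'
  have hbound : Computable fun x : ℕ × Candidate n => C * 2 ^ m x.1 :=
    Primrec.nat_mul.to_comp.comp (Computable.const C) (hpow 2)
  have hpowr : Primrec fun x : ℕ × Candidate n => 2 ^ x.1 :=
    primrec₂_pow.comp (Primrec.const 2) Primrec.fst
  refine Primrec.and.to_comp.comp (Primrec.and.to_comp.comp (Primrec.and.to_comp.comp ?_ ?_)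
    (Primrec.and.to_comp.comp ?_ ?_)) (Primrec.and.to_comp.comp ?_ ?_)
  · refine Primrec.nat_le.decide.to_comp.comp (hpow 4)
      (primrec_list_sum (fun i => ?_) _).to_comp
    exact primrec₂_pow.comp (Primrec.succ.comp (primrec_int_natAbs.comp (hp i))) (Primrec.const 2)
  · refine Primrec.nat_le.decide.to_comp.comp
      (primrec_list_sum (fun i => ?_) _).to_comp (hpow 4)
    exact primrec₂_pow.comp (Primrec.nat_sub.comp (primrec_int_natAbs.comp (hp i))
      (Primrec.const 1)) (Primrec.const 2)
  · exact Primrec.nat_le.decide.to_comp.comp hq.to_comp (hpow 2)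
  · refine computable_list_all (fun i => ?_) _
    refine Primrec.nat_le.decide.to_comp.comp (primrec_int_natAbs.to_comp.comp
      (primrec_int_sub.to_comp.comp ((primrec_eval_fin i).to_comp.comp (hF.comp ?_))
      ((primrec_eval_fin i).comp hX).to_comp)) (Computable.const 2)
    exact (Primrec.pair (Primrec.pair (Primrec.fst.comp hpq) (primrec_int_ofNat.comp hq))
      Primrec.fst).to_comp
  · refine computable_list_all (fun i => ?_) _
    refine Primrec.nat_le.decide.to_comp.comp (primrec_int_natAbs.to_comp.comp
      (primrec_int_sub.to_comp.comp (primrec_int_natMul.to_comp.comp (hpow 2) ?_)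
        (primrec_int_natMul.comp hpowr (hp i)).to_comp)) hbound
    exact ((primrec_eval_fin i).comp (Primrec.fst.comp hPQ)).to_comp
  · refine Primrec.nat_le.decide.to_comp.comp (primrec_int_natAbs.to_comp.comp
      (primrec_int_sub.to_comp.comp (primrec_int_natMul.to_comp.comp (hpow 2)
        (Primrec.snd.comp hPQ).to_comp)
        (primrec_int_natMul.comp hpowr (primrec_int_ofNat.comp hq)).to_comp)) hbound

/-- The modulus of computability of a map which stretches distances in the last variable by a
factor at least `L` is at least linear. -/
theorem two_pow_le_of_modulus {ψ : EuclideanSpace ℝ (Fin n) × ℝ → EuclideanSpace ℝ (Fin n)}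
    {L : ℝ} (hL : 0 < L)
    (hlip : ∀ z₁ ∈ paramDomain n, ∀ z₂ ∈ paramDomain n,
      L * √(‖z₁.1 - z₂.1‖ ^ 2 + (z₁.2 - z₂.2) ^ 2) ≤ ‖ψ z₁ - ψ z₂‖)
    {m : ℕ → ℕ} {F : ((Fin n → ℤ) × ℤ) × ℕ → (Fin n → ℤ)}
    (hF : ∀ z ∈ paramDomain n, ∀ (r : ℕ) (p : Fin n → ℤ) (q : ℤ),
      (∀ i, |(p i : ℝ) / 2 ^ m r - z.1 i| ≤ 1 / 2 ^ m r) →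
      |(q : ℝ) / 2 ^ m r - z.2| ≤ 1 / 2 ^ m r →
      ∀ i, |(F ((p, q), r) i : ℝ) / 2 ^ r - ψ z i| ≤ 1 / 2 ^ r)
    {e : EuclideanSpace ℝ (Fin n)} (he : e ∈ Metric.sphere (0 : EuclideanSpace ℝ (Fin n)) 1)
    (r : ℕ) : (2 : ℝ) ^ r ≤ 2 * n / L * 2 ^ m r := by
  have hpos : (0 : ℝ) < 2 ^ m r := by positivity
  have hposr : (0 : ℝ) < 2 ^ r := by positivity
  set p : Fin n → ℤ := fun i => round (2 ^ m r * e i) with hp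
  have hpe : ∀ i, |(p i : ℝ) / 2 ^ m r - e i| ≤ 1 / 2 ^ m r := by
    intro i
    have h1 := abs_sub_round (2 ^ m r * e i)
    have h2 : (p i : ℝ) / 2 ^ m r - e i = -(2 ^ m r * e i - p i) / 2 ^ m r := by field_simp; ring
    rw [h2, abs_div, abs_neg, abs_of_pos hpos]
    gcongr
    exact h1.trans (by norm_num)
  have h1le : 1 / (2 : ℝ) ^ m r ≤ 1 := by
    rw [div_le_one hpos]
    exact one_le_pow₀ (by norm_num)
  have hz₁ : (e, (0 : ℝ)) ∈ paramDomain n := ⟨he, by simp⟩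
  have hz₂ : (e, 1 / (2 : ℝ) ^ m r) ∈ paramDomain n := ⟨he, by positivity, h1le⟩
  -- The points `(e, 0)` and `(e, 2⁻ᵐ⁽ʳ⁾)` share the approximation `(p, 0)`, so one output of `F` is
  -- within `2⁻ʳ` of both images in each coordinate.
  have hc := hF _ hz₁ r p 0 hpe (by simp)
  have hc' := hF _ hz₂ r p 0 hpe (by simp)
  have hnorm : ‖ψ (e, 0) - ψ (e, 1 / 2 ^ m r)‖ ≤ n * (2 / 2 ^ r) := by
    refine norm_le_of_forall_abs_le _ (by positivity) fun i => ?_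
    have h1 := abs_le.1 (hc i)
    have h2 := abs_le.1 (hc' i)
    rw [PiLp.sub_apply, abs_le, show (2 : ℝ) / 2 ^ r = 1 / 2 ^ r + 1 / 2 ^ r by ring]
    constructor <;> linarith [h1.1, h1.2, h2.1, h2.2]
  have h := (hlip _ hz₁ _ hz₂).trans hnorm
  have hsq : √(‖e - e‖ ^ 2 + (0 - 1 / (2 : ℝ) ^ m r) ^ 2) = 1 / 2 ^ m r := by
    rw [sub_self, norm_zero, zero_sub, neg_sq]
    simp only [ne_eq, OfNat.ofNat_ne_zero, not_false_eq_true, zero_pow, zero_add]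
    exact Real.sqrt_sq (by positivity)
  simp only [hsq] at h
  rw [mul_one_div, mul_div_assoc', div_le_div_iff₀ hpos hposr] at h
  rw [div_mul_eq_mul_div, le_div_iff₀ hL]
  linarith

end Kakeya

/-! ### Soundness of the test, bounded multiplicity and completeness -/

namespace Kakeya

variable {n : ℕ}

theorem abs_div_sub_div_le {a b c s : ℝ} (hs : 0 < s) (h : |a - b| ≤ c) :
    |a / s - b / s| ≤ c / s := by
  rw [← sub_div, abs_div, abs_of_pos hs]
  gcongr

theorem abs_mul_sub_mul_le {a b c s : ℝ} (hs : 0 ≤ s) (h : |a - b| ≤ c) :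
    |s * a - s * b| ≤ s * c := by
  rw [← mul_sub, abs_mul, abs_of_nonneg hs]
  gcongr

/-- What the test `parameterTest` guarantees. -/
theorem exists_mem_paramDomain_of_parameterTest
    {ψ : EuclideanSpace ℝ (Fin n) × ℝ → EuclideanSpace ℝ (Fin n)}
    {m : ℕ → ℕ} {F : ((Fin n → ℤ) × ℤ) × ℕ → (Fin n → ℤ)}
    (hF : ∀ z ∈ paramDomain n, ∀ (r : ℕ) (p : Fin n → ℤ) (q : ℤ),
      (∀ i, |(p i : ℝ) / 2 ^ m r - z.1 i| ≤ 1 / 2 ^ m r) →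
      |(q : ℝ) / 2 ^ m r - z.2| ≤ 1 / 2 ^ m r →
      ∀ i, |(F ((p, q), r) i : ℝ) / 2 ^ r - ψ z i| ≤ 1 / 2 ^ r)
    {C r : ℕ} (hC : (2 : ℝ) ^ r ≤ C * 2 ^ m r) {w : Candidate n}
    (hw : parameterTest m F C r w = true) :
    ∃ z ∈ paramDomain n, (∀ i, |(w.1 i : ℝ) - 2 ^ r * ψ z i| ≤ 3) ∧
      (∀ i, |(w.2.1.1 i : ℝ) - 2 ^ r * z.1 i| ≤ 2 * C) ∧ |(w.2.1.2 : ℝ) - 2 ^ r * z.2| ≤ 2 * C := by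
  obtain ⟨X, ⟨P, Q⟩, p, q⟩ := w
  obtain ⟨⟨⟨h1, h2⟩, h3, h4⟩, h5, h6⟩ := parameterTest_iff.1 hw
  have hpos : (0 : ℝ) < 2 ^ m r := by positivity
  have hposr : (0 : ℝ) < 2 ^ r := by positivity
  obtain ⟨y, hy, hysum⟩ := exists_mem_cube_sum_sq_eq h1 h2
  have hye : ∀ i, |(p i : ℝ) / 2 ^ m r - y i / 2 ^ m r| ≤ 1 / 2 ^ m r := fun i =>
    abs_div_sub_div_le hpos (hy i)
  have hz : ((WithLp.toLp 2 fun i => y i / 2 ^ m r : EuclideanSpace ℝ (Fin n)),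
      (q : ℝ) / 2 ^ m r) ∈ paramDomain n := by
    refine ⟨(mem_sphere_iff_sum_sq _).2 ?_, by positivity, ?_⟩
    · simp only [div_pow]
      rw [← Finset.sum_div, hysum, div_eq_one_iff_eq (by positivity)]
      push_cast
      rw [← pow_mul, mul_comm, pow_mul]
      norm_num
    · rw [div_le_one hpos]
      exact_mod_cast h3
  have hround : ∀ {a b : ℝ}, |2 ^ m r * a - 2 ^ r * b| ≤ C * 2 ^ m r →
      |a - 2 ^ r * (b / 2 ^ m r)| ≤ C := by
    intro a b h
    have := abs_div_sub_div_le hpos h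
    rwa [mul_div_cancel_left₀ _ hpos.ne', mul_div_cancel_right₀ _ hpos.ne', mul_div_assoc] at this
  refine ⟨_, hz, fun i => ?_, fun i => ?_, ?_⟩
  -- The bound `3` is `1` for the error of `F` at scale `2⁻ʳ` plus the `2` allowed by the test.
  · have hFi := abs_mul_sub_mul_le hposr.le (hF _ hz r p q hye (by simp) i)
    rw [mul_div_cancel₀ _ hposr.ne', mul_one_div_cancel hposr.ne'] at hFi
    have := abs_sub_le (X i : ℝ) (F ((p, q), r) i)
      (2 ^ r * ψ (WithLp.toLp 2 fun i => y i / 2 ^ m r, (q : ℝ) / 2 ^ m r) i)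
    have h4i := h4 i
    rw [abs_sub_comm] at h4i
    linarith
  · have e1 := hround (h5 i)
    have e2 := abs_mul_sub_mul_le hposr.le (hye i)
    -- Moving from `p` to the sphere point `y` costs one unit at scale `2⁻ᵐ⁽ʳ⁾`; it is at most `C`
    -- units at scale `2⁻ʳ` because the modulus is at least linear.
    have e3 : (2 : ℝ) ^ r * (1 / 2 ^ m r) ≤ C := by
      rw [mul_one_div, div_le_iff₀ hpos]; exact hC
    have := abs_sub_le (P i : ℝ) (2 ^ r * (p i / 2 ^ m r)) (2 ^ r * (y i / 2 ^ m r))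
    simp only
    linarith
  · have e1 := hround h6
    have : (0 : ℝ) ≤ C := Nat.cast_nonneg C
    simp only
    linarith

/-- The parameters which are related to the same point by `parameterTest` are close together. -/
theorem exists_abs_sub_le_of_parameterTest
    {ψ : EuclideanSpace ℝ (Fin n) × ℝ → EuclideanSpace ℝ (Fin n)} {L : ℝ} (hL : 0 < L)
    (hlip : ∀ z₁ ∈ paramDomain n, ∀ z₂ ∈ paramDomain n,
      L * √(‖z₁.1 - z₂.1‖ ^ 2 + (z₁.2 - z₂.2) ^ 2) ≤ ‖ψ z₁ - ψ z₂‖)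
    {m : ℕ → ℕ} {F : ((Fin n → ℤ) × ℤ) × ℕ → (Fin n → ℤ)}
    (hF : ∀ z ∈ paramDomain n, ∀ (r : ℕ) (p : Fin n → ℤ) (q : ℤ),
      (∀ i, |(p i : ℝ) / 2 ^ m r - z.1 i| ≤ 1 / 2 ^ m r) →
      |(q : ℝ) / 2 ^ m r - z.2| ≤ 1 / 2 ^ m r →
      ∀ i, |(F ((p, q), r) i : ℝ) / 2 ^ r - ψ z i| ≤ 1 / 2 ^ r)
    {C : ℕ} (hC : ∀ r, (2 : ℝ) ^ r ≤ C * 2 ^ m r) :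
    ∃ D : ℕ, ∀ r (w w' : Candidate n), parameterTest m F C r w = true →
      parameterTest m F C r w' = true → w.1 = w'.1 →
      (∀ i, |w'.2.1.1 i - w.2.1.1 i| ≤ (D : ℤ)) ∧ |w'.2.1.2 - w.2.1.2| ≤ (D : ℤ) := by
  -- Each grid parameter is within `2 * C` of its true parameter. The two images are both within `3`
  -- of the common `X` coordinatewise, so the true parameters differ by at most `n * 6 / L`, all in
  -- units of `2⁻ʳ`.
  obtain ⟨D, hD⟩ := exists_nat_ge (4 * C + n * 6 / L : ℝ)
  refine ⟨D, fun r w w' hw hw' hX => ?_⟩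
  obtain ⟨z, hz, hz1, hz2, hz3⟩ := exists_mem_paramDomain_of_parameterTest hF (hC r) hw
  obtain ⟨z', hz', hz1', hz2', hz3'⟩ := exists_mem_paramDomain_of_parameterTest hF (hC r) hw'
  have hposr : (0 : ℝ) < 2 ^ r := by positivity
  have hnorm : ‖ψ z' - ψ z‖ ≤ n * (6 / 2 ^ r) := by
    refine norm_le_of_forall_abs_le _ (by positivity) fun i => ?_
    have h1 := abs_le.1 (hz1 i)
    have h2 := abs_le.1 (hz1' i)
    rw [← hX] at h2
    rw [PiLp.sub_apply, le_div_iff₀ hposr, ← abs_of_pos hposr, ← abs_mul, abs_le]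
    constructor <;> linarith [h1.1, h1.2, h2.1, h2.2]
  have hdist := (hlip z' hz' z hz).trans hnorm
  have hscale : ∀ {s : ℝ}, |s| ≤ √(‖z'.1 - z.1‖ ^ 2 + (z'.2 - z.2) ^ 2) →
      |2 ^ r * s| ≤ n * 6 / L := by
    intro s hs
    have h1 : L * |s| ≤ n * (6 / 2 ^ r) := (mul_le_mul_of_nonneg_left hs hL.le).trans hdist
    rw [abs_mul, abs_of_pos hposr, le_div_iff₀ hL]
    rw [mul_div_assoc', le_div_iff₀ hposr] at h1
    linarith
  have hcomb : ∀ {a a' : ℤ} {u u' : ℝ}, |(a : ℝ) - 2 ^ r * u| ≤ 2 * C →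
      |(a' : ℝ) - 2 ^ r * u'| ≤ 2 * C →
      |u' - u| ≤ √(‖z'.1 - z.1‖ ^ 2 + (z'.2 - z.2) ^ 2) → |a' - a| ≤ (D : ℤ) := by
    intro a a' u u' h h' hu
    have h1 := abs_le.1 (hscale hu)
    have h2 := abs_le.1 h
    have h3 := abs_le.1 h'
    have : |(a' : ℝ) - a| ≤ (D : ℝ) := by
      refine le_trans (abs_le.2 ?_) hD
      constructor <;> linarith [h1.1, h1.2, h2.1, h2.2, h3.1, h3.2]
    exact_mod_cast this
  refine ⟨fun i => hcomb (hz2 i) (hz2' i) ?_, hcomb hz3 hz3' ?_⟩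
  · refine Real.le_sqrt_of_sq_le ?_
    have := abs_apply_le_norm (z'.1 - z.1) i
    rw [PiLp.sub_apply] at this
    have h2 := pow_le_pow_left₀ (abs_nonneg _) this 2
    linarith [sq_nonneg (z'.2 - z.2)]
  · refine Real.le_sqrt_of_sq_le ?_
    rw [sq_abs]
    linarith [sq_nonneg ‖z'.1 - z.1‖]

/-- All parameters linked to `X` lie in a box of radius `D` around any one of them. -/
theorem exists_card_parameterTest_le {m : ℕ → ℕ} {F : ((Fin n → ℤ) × ℤ) × ℕ → (Fin n → ℤ)}
    {C D : ℕ} (hD : ∀ r (w w' : Candidate n), parameterTest m F C r w = true →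
      parameterTest m F C r w' = true → w.1 = w'.1 →
      (∀ i, |w'.2.1.1 i - w.2.1.1 i| ≤ (D : ℤ)) ∧ |w'.2.1.2 - w.2.1.2| ≤ (D : ℤ)) (r X : ℕ) :
    ∃ T : Finset ℕ, T.card ≤ (2 * D + 1) ^ (n + 1) ∧ ∀ w : Candidate n,
      parameterTest m F C r w = true → Encodable.encode (List.ofFn w.1) = X →
      Nat.pair (Encodable.encode (List.ofFn w.2.1.1)) (Encodable.encode [w.2.1.2]) ∈ T := by
  by_cases hex : ∃ w : Candidate n, parameterTest m F C r w = true ∧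
      Encodable.encode (List.ofFn w.1) = X
  · obtain ⟨w₀, hw₀, hX₀⟩ := hex
    refine ⟨((Fintype.piFinset fun i => Finset.Icc (w₀.2.1.1 i - D) (w₀.2.1.1 i + D)) ×ˢ
      Finset.Icc (w₀.2.1.2 - D) (w₀.2.1.2 + (D : ℤ))).image fun x =>
        Nat.pair (Encodable.encode (List.ofFn x.1)) (Encodable.encode [x.2]), ?_, ?_⟩
    · refine Finset.card_image_le.trans ?_
      have hcard : ∀ b : ℤ, (b + D + 1 - (b - D)).toNat = 2 * D + 1 := by intro b; omega
      rw [Finset.card_product, Fintype.card_piFinset]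
      simp only [Int.card_Icc, hcard, Finset.prod_const, Finset.card_univ, Fintype.card_fin]
      rw [pow_succ]
    · intro w hw hX
      have hXX : w₀.1 = w.1 := List.ofFn_injective (Encodable.encode_injective (hX₀.trans hX.symm))
      obtain ⟨h1, h2⟩ := hD r w₀ w hw₀ hw hXX
      refine Finset.mem_image.2 ⟨w.2.1, Finset.mem_product.2 ⟨Fintype.mem_piFinset.2 fun i => ?_,
        ?_⟩, rfl⟩
      · have := abs_le.1 (h1 i)
        exact Finset.mem_Icc.2 ⟨by linarith, by linarith⟩
      · have := abs_le.1 h2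
        exact Finset.mem_Icc.2 ⟨by linarith, by linarith⟩
  · push Not at hex
    exact ⟨∅, by simp, fun w hw hX => absurd hX (hex w hw)⟩

/-- The parameter of a point passes the test. -/
theorem exists_parameterTest {ψ : EuclideanSpace ℝ (Fin n) × ℝ → EuclideanSpace ℝ (Fin n)}
    {m : ℕ → ℕ} {F : ((Fin n → ℤ) × ℤ) × ℕ → (Fin n → ℤ)}
    (hF : ∀ z ∈ paramDomain n, ∀ (r : ℕ) (p : Fin n → ℤ) (q : ℤ),
      (∀ i, |(p i : ℝ) / 2 ^ m r - z.1 i| ≤ 1 / 2 ^ m r) →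
      |(q : ℝ) / 2 ^ m r - z.2| ≤ 1 / 2 ^ m r →
      ∀ i, |(F ((p, q), r) i : ℝ) / 2 ^ r - ψ z i| ≤ 1 / 2 ^ r)
    {C r : ℕ} (hC : (2 : ℝ) ^ r + 2 ^ m r ≤ C * 2 ^ m r)
    {z : EuclideanSpace ℝ (Fin n) × ℝ} (hz : z ∈ paramDomain n) :
    ∃ p q, parameterTest m F C r (fun i => round (2 ^ r * ψ z i),
      (fun i => round (2 ^ r * z.1 i), round (2 ^ r * z.2)), p, q) = true := by
  have hpos : (0 : ℝ) < 2 ^ m r := by positivity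
  have hposr : (0 : ℝ) < 2 ^ r := by positivity
  obtain ⟨hz1, hz20, hz21⟩ := hz
  have hround : ∀ a : ℝ, |(round a : ℝ) - a| ≤ 1 := fun a => by
    rw [abs_sub_comm]; exact (abs_sub_round a).trans (by norm_num)
  set p : Fin n → ℤ := fun i => round (2 ^ m r * z.1 i) with hp
  -- The floor keeps `q` a natural number with `q ≤ 2 ^ m r`, so that the approximation itself lies
  -- in `[0, 1]`.
  set q : ℕ := ⌊2 ^ m r * z.2⌋₊ with hq
  have hpz : ∀ i, |(p i : ℝ) - 2 ^ m r * z.1 i| ≤ 1 := fun i => hround _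
  have hqz : |(q : ℝ) - 2 ^ m r * z.2| ≤ 1 := by
    have h1 := Nat.floor_le (mul_nonneg hpos.le hz20)
    have h2 := Nat.lt_floor_add_one (2 ^ m r * z.2)
    rw [abs_le]
    constructor <;> linarith
  have hscale : ∀ {a b : ℝ}, |a - 2 ^ m r * b| ≤ 1 → |a / 2 ^ m r - b| ≤ 1 / 2 ^ m r := by
    intro a b h
    have := abs_div_sub_div_le hpos h
    rwa [mul_div_cancel_left₀ _ hpos.ne'] at this
  have hclose : ∀ {a b : ℝ}, |a - 2 ^ m r * b| ≤ 1 →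
      |2 ^ m r * (round (2 ^ r * b) : ℝ) - 2 ^ r * a| ≤ C * 2 ^ m r := by
    intro a b h
    have h1 := abs_mul_sub_mul_le hpos.le (hround (2 ^ r * b))
    have h2 := abs_mul_sub_mul_le hposr.le h
    rw [abs_sub_comm] at h2
    have := abs_sub_le (2 ^ m r * (round (2 ^ r * b) : ℝ)) (2 ^ m r * (2 ^ r * b)) (2 ^ r * a)
    rw [show (2 : ℝ) ^ r * (2 ^ m r * b) = 2 ^ m r * (2 ^ r * b) by ring] at h2
    linarith
  have hsum : ∑ i, (2 ^ m r * z.1 i) ^ 2 = (4 ^ m r : ℝ) := by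
    simp only [mul_pow]
    rw [← Finset.mul_sum, (mem_sphere_iff_sum_sq _).1 hz1, mul_one, ← pow_mul, mul_comm, pow_mul]
    norm_num
  have habs : ∀ i, ((p i).natAbs : ℝ) = |(p i : ℝ)| := fun i => by
    rw [← Int.cast_abs, Int.abs_eq_natAbs, Int.cast_natCast]
  refine ⟨p, q, parameterTest_iff.2 ⟨⟨⟨?_, ?_⟩, ?_, ?_⟩, fun i => hclose (hpz i), hclose hqz⟩⟩
  · have : (4 ^ m r : ℝ) ≤ ((∑ i, ((p i).natAbs + 1) ^ 2 : ℕ) : ℝ) := by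
      rw [← hsum, Nat.cast_sum]
      refine Finset.sum_le_sum fun i _ => ?_
      push_cast
      rw [← sq_abs]
      refine pow_le_pow_left₀ (abs_nonneg _) ?_ 2
      have h1 := abs_sub_abs_le_abs_sub (2 ^ m r * z.1 i) (p i)
      have h2 := hpz i
      rw [abs_sub_comm] at h2
      have h3 := habs i
      linarith
    exact_mod_cast this
  · have : ((∑ i, ((p i).natAbs - 1) ^ 2 : ℕ) : ℝ) ≤ (4 ^ m r : ℝ) := by
      rw [← hsum, Nat.cast_sum]
      refine Finset.sum_le_sum fun i _ => ?_
      push_cast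
      rw [← sq_abs (2 ^ m r * z.1 i)]
      refine pow_le_pow_left₀ (Nat.cast_nonneg _) ?_ 2
      have h1 := abs_sub_abs_le_abs_sub (p i : ℝ) (2 ^ m r * z.1 i)
      have h2 := hpz i
      have h3 := habs i
      rcases Nat.eq_zero_or_pos (p i).natAbs with h0 | h0
      · simp only [h0, Nat.zero_sub, Nat.cast_zero]; positivity
      · rw [Nat.cast_sub h0, Nat.cast_one]
        linarith
    exact_mod_cast this
  · refine Nat.floor_le_of_le ?_
    push_cast
    exact mul_le_of_le_one_right hpos.le hz21
  · intro i
    have h1 := abs_mul_sub_mul_le hposr.le (hF z ⟨hz1, hz20, hz21⟩ r p q (fun i => hscale (hpz i))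
      (by rw [Int.cast_natCast]; exact hscale hqz) i)
    rw [mul_div_cancel₀ _ hposr.ne', mul_one_div_cancel hposr.ne'] at h1
    have h2 := hround (2 ^ r * ψ z i)
    rw [abs_sub_comm] at h2
    have := abs_sub_le (F ((p, q), r) i : ℝ) (2 ^ r * ψ z i) (round (2 ^ r * ψ z i))
    linarith

end Kakeya

/-! ### Asymptotics: logarithmic errors and dimensions -/

namespace Kakeya

variable {n : ℕ} {A : Set ℕ}

/-- A length of headers which is logarithmic in the precision `r`. -/
def headerLength (r : ℕ) : ℕ := 2 * (Nat.log 2 r + 1)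

/-- The quantities placed in headers are bounded linearly in `r`; the bound `r * r` eventually
absorbs all constants. -/
theorem lt_two_pow_headerLength {a r : ℕ} (h : a ≤ r * r) : a < 2 ^ headerLength r := by
  have hr := Nat.lt_pow_succ_log_self (b := 2) (by norm_num) r
  rw [headerLength, mul_comm, pow_mul]
  calc a ≤ r ^ 2 := by rwa [sq]
    _ < _ := Nat.pow_lt_pow_left hr (by norm_num)

theorem headerLength_le (r : ℕ) : headerLength r ≤ 2 * r + 2 := by
  have := Nat.log_le_self 2 r
  unfold headerLength
  omega

theorem tendsto_headerLength_div :
    Tendsto (fun r : ℕ => (headerLength r : ℝ) / r) atTop (nhds 0) := by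
  have h1 : Tendsto (fun r : ℕ => Real.log r ^ 1 / (1 * (r : ℝ) + 0)) atTop (nhds 0) :=
    (Real.tendsto_pow_log_div_mul_add_atTop 1 0 1 one_ne_zero).comp tendsto_natCast_atTop_atTop
  have h2 : Tendsto (fun r : ℕ => (2 : ℝ) / r) atTop (nhds 0) :=
    tendsto_const_div_atTop_nhds_zero_nat 2
  have h3 := (h1.const_mul (2 / Real.log 2)).add h2
  rw [mul_zero, add_zero] at h3
  refine squeeze_zero (fun r => by positivity) (fun r => ?_) h3
  have h4 := Real.natLog_le_logb r 2
  rw [Nat.cast_ofNat, Real.logb] at h4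
  have h5 : (headerLength r : ℝ) ≤ 2 / Real.log 2 * Real.log r + 2 := by
    rw [headerLength]
    push_cast
    calc 2 * ((Nat.log 2 r : ℝ) + 1) ≤ 2 * (Real.log r / Real.log 2 + 1) := by gcongr
      _ = _ := by ring
  calc (headerLength r : ℝ) / r ≤ (2 / Real.log 2 * Real.log r + 2) / r := by gcongr
    _ = _ := by rw [pow_one, one_mul, add_zero]; ring

theorem IsUniversalMachine.exists_complexity_approx_le {U : Machine} (hU : IsUniversalMachine A U)
    (x : EuclideanSpace ℝ (Fin n)) :
    ∃ c, ∀ᶠ r in atTop, complexity U (approx x r) ≤ r * n + 4 * headerLength r + c := by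
  obtain ⟨c, hc⟩ := hU.exists_complexity_vector_le n
  -- The `+ 1` pays for rounding, so all numerators are at most `2 ^ (r + b)` in absolute value.
  obtain ⟨b, hb⟩ := pow_unbounded_of_one_lt (‖x‖ + 1) (one_lt_two (α := ℝ))
  refine ⟨(b + 2) * n + c, ?_⟩
  filter_upwards [eventually_ge_atTop (n + b + 2 + b * n + 2 * n)] with r hr
  have hr1 : 1 ≤ r := by omega
  have hrr : ∀ a, a ≤ b + 2 + n → a * r ≤ r * r := fun a ha => Nat.mul_le_mul_right r (by omega)
  refine (hc (headerLength r) (r + b) (fun i => round ((2 : ℝ) ^ r * x i)) (fun i => ?_)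
    (lt_two_pow_headerLength ?_) (lt_two_pow_headerLength ?_)).trans (by
      rw [show (r + b + 2) * n = r * n + (b + 2) * n by ring]; omega)
  · have h1 := abs_sub_round ((2 : ℝ) ^ r * x i)
    rw [abs_sub_comm] at h1
    have h2 := abs_sub_abs_le_abs_sub (round ((2 : ℝ) ^ r * x i) : ℝ) (2 ^ r * x i)
    have h3 := abs_apply_le_norm x i
    have h4 : (1 : ℝ) ≤ 2 ^ r := one_le_pow₀ (by norm_num)
    have h5 : |(2 : ℝ) ^ r * x i| ≤ 2 ^ r * ‖x‖ := by
      rw [abs_mul, abs_of_nonneg (by positivity)]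
      gcongr
    have h6 : (2 : ℝ) ^ r * (‖x‖ + 1) ≤ 2 ^ r * 2 ^ b := by gcongr
    have h7 : |(round ((2 : ℝ) ^ r * x i) : ℝ)| ≤ 2 ^ (r + b) := by
      rw [pow_add]
      linarith
    rw [← Int.cast_abs, Int.abs_eq_natAbs] at h7
    exact_mod_cast h7
  · nlinarith
  · nlinarith

theorem IsUniversalMachine.exists_complexity_parameter_le {U : Machine}
    (hU : IsUniversalMachine A U)
    {ψ : EuclideanSpace ℝ (Fin n) × ℝ → EuclideanSpace ℝ (Fin n)}
    (hbilip : EffectivelyBiLipschitzOn ψ (paramDomain n))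
    (hcomp : EffectivelyComputableOn ψ (paramDomain n))
    {z : EuclideanSpace ℝ (Fin n) × ℝ} (hz : z ∈ paramDomain n) :
    ∃ c, ∀ᶠ r in atTop, complexity U (approx z.1 r) +
      condComplexity U (approxReal z.2 r) (approx z.1 r) ≤
        complexity U (approx (ψ z) r) + 32 * headerLength r + c := by
  obtain ⟨L, L', hL, -, -, -, hL'⟩ := hbilip
  obtain ⟨m, F, hm, hFc, hF⟩ := hcomp
  have hlip : ∀ z₁ ∈ paramDomain n, ∀ z₂ ∈ paramDomain n,
      L * √(‖z₁.1 - z₂.1‖ ^ 2 + (z₁.2 - z₂.2) ^ 2) ≤ ‖ψ z₁ - ψ z₂‖ :=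
    fun z₁ h₁ z₂ h₂ => (hL' z₁ h₁ z₂ h₂).1
  -- The term `2 * n / L` bounds `2 ^ r / 2 ^ m r`, and the `1` pays for rounding the parameter to
  -- the grid.
  obtain ⟨C, hC⟩ := exists_nat_ge (2 * n / L + 1)
  have hmod : ∀ r, (2 : ℝ) ^ r + 2 ^ m r ≤ C * 2 ^ m r := by
    intro r
    have h1 := two_pow_le_of_modulus hL hlip hF hz.1 r
    have h2 : (2 * n / L + 1) * (2 : ℝ) ^ m r ≤ C * 2 ^ m r := by gcongr
    linarith
  obtain ⟨D, hD⟩ := exists_abs_sub_le_of_parameterTest hL hlip hF (C := C) fun r =>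
    (le_add_of_nonneg_right (by positivity)).trans (hmod r)
  have hlist : Computable fun w : Candidate n => Encodable.encode (List.ofFn w.1) :=
    (Primrec.encode.comp ((primrec_list_ofFn n).comp Primrec.fst)).to_comp
  have hlistP : Computable fun w : Candidate n => Encodable.encode (List.ofFn w.2.1.1) :=
    (Primrec.encode.comp ((primrec_list_ofFn n).comp
      (Primrec.fst.comp (Primrec.fst.comp Primrec.snd)))).to_comp
  have hlistQ : Computable fun w : Candidate n => Encodable.encode [w.2.1.2] :=
    (Primrec.encode.comp (Primrec.list_cons.comp
      (Primrec.snd.comp (Primrec.fst.comp Primrec.snd)) (Primrec.const []))).to_comp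
  obtain ⟨d, hd⟩ : ∃ d, (2 * D + 1) ^ (n + 1) ≤ 2 ^ d := ⟨_, Nat.lt_two_pow_self.le⟩
  obtain ⟨c, hc⟩ := hU.exists_complexity_add_le_of_relation
    (computable₂_parameterTest hm hFc C) hlist hlistP hlistQ d (fun r X => by
      obtain ⟨T, hT, hT'⟩ := exists_card_parameterTest_le hD r X
      exact ⟨T, hT.trans hd, hT'⟩)
  obtain ⟨c', hc'⟩ := hU.exists_complexity_approx_le (ψ z)
  refine ⟨c, ?_⟩
  -- The a priori bound gives complexity at most `(n + 8) * r + 8 + c'`; one further `r` absorbs the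
  -- constants, and `n + 9 ≤ r` brings the total below `r * r`.
  filter_upwards [hc', eventually_ge_atTop (n + 8 + (8 + c' + d + 1))] with r hr hr'
  obtain ⟨p, q, hpq⟩ := exists_parameterTest hF (hmod r) hz
  refine hc (headerLength r) r _ hpq (lt_two_pow_headerLength (by nlinarith))
    (lt_two_pow_headerLength ?_)
  have h1 := headerLength_le r
  have h2 : (n + 8 + 1) * r ≤ r * r := Nat.mul_le_mul_right r (by omega)
  change complexity U (approx (ψ z) r) + d + 1 ≤ r * r
  nlinarith

theorem tendsto_header_error (a : ℝ) (c b : ℝ) :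
    Tendsto (fun r : ℕ => (((b * r + a * headerLength r + c) / r : ℝ) : EReal)) atTop
      (nhds (b : EReal)) := by
  refine EReal.tendsto_coe.2 ?_
  have h := (tendsto_headerLength_div.const_mul a).add (tendsto_const_div_atTop_nhds_zero_nat c)
  have h' := h.const_add b
  rw [mul_zero, add_zero, add_zero] at h'
  refine h'.congr' ?_
  filter_upwards [eventually_gt_atTop 0] with r hr
  have : (r : ℝ) ≠ 0 := by positivity
  field_simp
  ring

theorem IsUniversalMachine.algDim_le {U : Machine} (hU : IsUniversalMachine A U)
    (x : EuclideanSpace ℝ (Fin n)) : algDim U x ≤ ((n : ℝ) : EReal) := by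
  obtain ⟨c, hc⟩ := hU.exists_complexity_approx_le x
  rw [algDim, ← (tendsto_header_error 4 c n).liminf_eq]
  refine liminf_le_liminf ?_
  filter_upwards [hc] with r hr
  refine EReal.coe_le_coe_iff.2 ?_
  gcongr
  have : (complexity U (approx x r) : ℝ) ≤ ((r * n + 4 * headerLength r + c : ℕ) : ℝ) := by
    exact_mod_cast hr
  push_cast at this
  linarith

theorem IsUniversalMachine.algDim_add_condAlgDim_le {U : Machine} (hU : IsUniversalMachine A U)
    {ψ : EuclideanSpace ℝ (Fin n) × ℝ → EuclideanSpace ℝ (Fin n)}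
    (hbilip : EffectivelyBiLipschitzOn ψ (paramDomain n))
    (hcomp : EffectivelyComputableOn ψ (paramDomain n))
    {z : EuclideanSpace ℝ (Fin n) × ℝ} (hz : z ∈ paramDomain n) :
    algDim U z.1 + condAlgDim U z.2 z.1 ≤ algDim U (ψ z) := by
  obtain ⟨c, hc⟩ := hU.exists_complexity_parameter_le hbilip hcomp hz
  -- The negated error enters as a third summand with limit `0`, so superadditivity of `liminf`
  -- handles it together with the two complexities.
  have herr := (tendsto_header_error (-32) (-c) 0).liminf_eq
  rw [EReal.coe_zero] at herr
  rw [← add_zero (algDim U z.1 + _), ← herr, algDim, condAlgDim]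
  refine (add_le_add_left EReal.le_liminf_add _).trans (EReal.le_liminf_add.trans ?_)
  refine liminf_le_liminf ?_
  filter_upwards [hc] with r hr
  simp only [Pi.add_apply]
  rw [← EReal.coe_add, ← EReal.coe_add]
  refine EReal.coe_le_coe_iff.2 ?_
  rw [← add_div, ← add_div]
  gcongr
  have : ((complexity U (approx z.1 r) + condComplexity U (approxReal z.2 r) (approx z.1 r) : ℕ) : ℝ)
      ≤ ((complexity U (approx (ψ z) r) + 32 * headerLength r + c : ℕ) : ℝ) := by exact_mod_cast hr
  push_cast at this
  linarith

end Kakeya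

theorem corollary3 {n : ℕ} (E : Set (EuclideanSpace ℝ (Fin n))) (hE : Kakeya.IsKakeyaSet E)
    (a : EuclideanSpace ℝ (Fin n) → EuclideanSpace ℝ (Fin n))
    (hmaps : Set.MapsTo (Kakeya.segmentMap a) (Kakeya.paramDomain n) E)
    (hbilip : Kakeya.EffectivelyBiLipschitzOn (Kakeya.segmentMap a) (Kakeya.paramDomain n))
    (hinj : Set.InjOn (Kakeya.segmentMap a) (Kakeya.paramDomain n))
    (hcomp : Kakeya.EffectivelyComputableOn (Kakeya.segmentMap a) (Kakeya.paramDomain n))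
    (A : Set ℕ) (U : Kakeya.Machine) (hU : Kakeya.IsUniversalMachine A U)
    (x : EuclideanSpace ℝ (Fin n)) (hx : x ∈ E)
    (e : EuclideanSpace ℝ (Fin n)) (he : e ∈ Metric.sphere (0 : EuclideanSpace ℝ (Fin n)) 1)
    (t : ℝ) (ht : t ∈ Set.Icc (0 : ℝ) 1) (hxet : x = a e + t • e)
    (hdim_e : Kakeya.algDim U e = (((n : ℝ) - 1 : ℝ) : EReal))
    (hdim_t : Kakeya.condAlgDim U t e = 1) :
    Kakeya.algDim U x = ((n : ℝ) : EReal) := by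
  refine le_antisymm (hU.algDim_le x) ?_
  have hz : (e, t) ∈ Kakeya.paramDomain n := ⟨he, ht⟩
  have h := hU.algDim_add_condAlgDim_le hbilip hcomp hz
  rw [hdim_e, hdim_t, ← EReal.coe_one, ← EReal.coe_add, sub_add_cancel] at h
  rw [hxet]
  exact h
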